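/- Let $n\ge 1$ and $1<p<\infty$. On $\mathbb{R}^{n+1}=\mathbb{R}^n\times\mathbb{R}$ let $d((x,t),(y,s))=\max(|x-y|,|t-s|^{1/p})$. A parabolic cylinder is an open ball $P=B_d(z,\rho)$ with $z=(x,t)$ and $\rho>0$. For $a>1$ and $\theta\ge 1$ let $$P^{\pm,a}=P\pm(0,a\rho^p)=B_d\bigl((x,t\pm a\rho^p),\rho\bigr),\qquad \widetilde P^{a}=\operatorname{conv}(P^{+,a}\cup P^{-,a}),$$ and let $\theta\widetilde P^{a}$ be the parabolic dilate of $\widetilde P^a$ about $z$, that is, the set $\widetilde{Q}^{a}$ of the cylinder $Q=B_d(z,\theta\rho)$. For an open set $\Omega\subset\mathbb{R}^{n+1}$, $a>1$, $q>0$, $\theta\ge1$ and a real-valued measurable function $f$ on $\Omega$ let $$\|f\|_{\mathrm{PBMO}^+(a,q,\theta,\Omega)}=\sup_{\theta\widetilde P^{a}\subset\Omega}\ \inf_{c\in\mathbb{R}}\Bigl(\frac{1}{|P^{+,a}|}\int_{P^{+,a}}(f-c)_+^q\,dz+\frac{1}{|P^{-,a}|}\int_{P^{-,a}}(f-c)_-^q\,dz\Bigr)^{1/q}\in[0,\infty],$$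 where the supremum is over parabolic cylinders $P$, and let $\|f\|_{\mathrm{PBMO}^+(\Omega)}=\|f\|_{\mathrm{PBMO}^+(3,1,1,\Omega)}$. The class $\mathrm{PBMO}^+(\Omega)$ consists of the locally integrable $f$ on $\Omega$ with $\|f\|_{\mathrm{PBMO}^+(\Omega)}<\infty$. Theorem. For all $a>1$, $q>0$, $\theta\ge 1$ there is a constant $C\in(0,\infty)$, depending only on $a,q,\theta,n,p$, such that for every open $\Omega\subset\mathbb{R}^{n+1}$ and every $f$ that belongs to $L^\delta_{\mathrm{loc}}(\Omega)$ for some $\delta>0$, $$C^{-1}\|f\|_{\mathrm{PBMO}^+(\Omega)}\le\|f\|_{\mathrm{PBMO}^+(a,q,\theta,\Omega)}\le C\,\|f\|_{\mathrm{PBMO}^+(\Omega)}$$ as an inequality in $[0,\infty]$. In particular, for such $f$, $\|f\|_{\mathrm{PBMO}^+(a,q,\theta,\Omega)}<\infty$ if and only if $f\in\mathrm{PBMO}^+(\Omega)$. -/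

import Mathlib

open MeasureTheory Set
open scoped ENNReal NNReal

noncomputable section

/-- Space-time `ℝⁿ × ℝ`; the first component is space (with the Euclidean norm), the second time.
Its `volume` is the `(n+1)`-dimensional Lebesgue measure. -/
abbrev SpaceTime (n : ℕ) : Type := EuclideanSpace ℝ (Fin n) × ℝ

/-- The parabolic distance `max (|x - y|, |t - s|^{1/p})`. -/
def parabolicDist {n : ℕ} (p : ℝ) (z w : SpaceTime n) : ℝ :=
  max ‖z.1 - w.1‖ (|z.2 - w.2| ^ (1 / p))

/-- The parabolic cylinder `B_d(z, ρ)`, an open ball of the parabolic distance. -/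
def parabolicCylinder {n : ℕ} (p : ℝ) (z : SpaceTime n) (ρ : ℝ) : Set (SpaceTime n) :=
  {w | parabolicDist p w z < ρ}

/-- Translation of a point in time, `(x, t) + s = (x, t + s)`. -/
def timeShift {n : ℕ} (z : SpaceTime n) (s : ℝ) : SpaceTime n := (z.1, z.2 + s)

/-- `P^{+,a} = P + a ρ^p`, for `P = B_d(z, ρ)`. -/
def upperCylinder {n : ℕ} (p a : ℝ) (z : SpaceTime n) (ρ : ℝ) : Set (SpaceTime n) :=
  parabolicCylinder p (timeShift z (a * ρ ^ p)) ρ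

/-- `P^{-,a} = P - a ρ^p`, for `P = B_d(z, ρ)`. -/
def lowerCylinder {n : ℕ} (p a : ℝ) (z : SpaceTime n) (ρ : ℝ) : Set (SpaceTime n) :=
  parabolicCylinder p (timeShift z (-(a * ρ ^ p))) ρ

/-- The convex hull of `P^{+,a} ∪ P^{-,a}`, for `P = B_d(z, ρ)`.
The set of `θP = B_d(z, θ ρ)` is the parabolic dilate by the factor `θ`, about `z`,
of the set of `P`. -/
def cylinderHull {n : ℕ} (p a : ℝ) (z : SpaceTime n) (ρ : ℝ) : Set (SpaceTime n) :=
  convexHull ℝ (upperCylinder p a z ρ ∪ lowerCylinder p a z ρ)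

/-- `inf_c (⨍_{P^{+,a}} (f - c)_+^q + ⨍_{P^{-,a}} (f - c)_-^q)^{1/q}`, for `P = B_d(z, ρ)`. -/
def parabolicOsc {n : ℕ} (p a q : ℝ) (f : SpaceTime n → ℝ) (z : SpaceTime n) (ρ : ℝ) : ℝ≥0∞ :=
  ⨅ c : ℝ,
    ((⨍⁻ w in upperCylinder p a z ρ, ENNReal.ofReal ((f w - c)⁺) ^ q ∂volume)
      + (⨍⁻ w in lowerCylinder p a z ρ, ENNReal.ofReal ((f w - c)⁻) ^ q ∂volume)) ^ (1 / q)

/-- The seminorm `‖f‖_{PBMO⁺(a, q, θ, Ω)}`, with values in `[0, ∞]`: the supremum of the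
oscillations over all parabolic cylinders `P` with `θ P̃^a ⊆ Ω`. -/
def pbmoSeminorm {n : ℕ} (p a q θ : ℝ) (Ω : Set (SpaceTime n)) (f : SpaceTime n → ℝ) : ℝ≥0∞ :=
  ⨆ (z : SpaceTime n) (ρ : ℝ) (_ : 0 < ρ) (_ : cylinderHull p a z (θ * ρ) ⊆ Ω),
    parabolicOsc p a q f z ρ

/-- The reference seminorm `‖f‖_{PBMO⁺(Ω)} = ‖f‖_{PBMO⁺(3, 1, 1, Ω)}`. -/
def pbmoRefSeminorm {n : ℕ} (p : ℝ) (Ω : Set (SpaceTime n)) (f : SpaceTime n → ℝ) : ℝ≥0∞ :=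
  pbmoSeminorm p 3 1 1 Ω f

/-- The class `PBMO⁺(Ω)`. -/
def MemPBMO {n : ℕ} (p : ℝ) (Ω : Set (SpaceTime n)) (f : SpaceTime n → ℝ) : Prop :=
  LocallyIntegrableOn f Ω ∧ pbmoRefSeminorm p Ω f < ∞

/-- `f ∈ L^δ_loc(Ω)`: `f` is in `L^δ(K)` for all compact `K ⊆ Ω`. -/
def MemLpLocOn {n : ℕ} (δ : ℝ) (Ω : Set (SpaceTime n)) (f : SpaceTime n → ℝ) : Prop :=
  ∀ K ⊆ Ω, IsCompact K → MemLp f (ENNReal.ofReal δ) (volume.restrict K)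

end

/-! ### Parabolic cylinders, their volume, and covering arguments. -/

section Geometry

variable {n : ℕ} {p : ℝ}

/-! All the seminorms are equivalent because each of them controls, and is controlled through, one
weak condition that mentions neither an exponent nor an integral. After division of `f` by a large
multiple of its seminorm, Chebyshev's inequality gives numbers `c z r` such that, up to a small
fraction `η` of the volume, `f ≤ c + 1` on the upper cylinder and `f ≥ c - 1` on the lower one
(`HasCenteredWeakOsc`; recentered at the upper cylinder, `HasWeakOsc`). It remains to recover, for
arbitrary new parameters, the integral bounds from this.

Numbers attached to two cylinders are compared in one way only: if the lower part of the first and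
the upper part of the second overlap in much more than the exceptional volume, then the first number
exceeds the second by at most 2 (`le_add_two_of_overlap`). This has two consequences.

First, a John-Nirenberg estimate: a stopping-time argument with a Vitali covering shows that
superlevel sets decay geometrically on half cylinders (`HasWeakOsc.volume_superlevel_le`), so all
powers are integrable there.

Second, a chain argument that changes the time lag from `a` to any `a' > 1`. From a point of the new
upper cylinder a chain of cylinders of growing radii runs backward in time to the axis, and then
down the axis to a fixed central cylinder (`HasWeakOsc.chain_bound`). Spatial steps comparable to
the radius cost time of order radius to the power `p`; as `p > 1`, small cylinders can traverse the
space within an arbitrarily short time, so any gap `a' - 1 > 0` suffices. The length of the chain is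
logarithmic in the distance to the lateral and top boundary, while the layer of points needing
length `m` has volume of order `lam⁻¹ ^ m`. Hence the sum of layer volume times `(m + 1) ^ q`
converges.

The central number is `c z R` for a cylinder with the same center `z`. Reflecting time and replacing
`f` by `-f` turns it into `-c z R`, so the same constant serves on the lower cylinder. The dilation
factor of the given seminorm is absorbed by small chain cylinders, and that of the new one only
restricts the supremum. -/

lemma mem_parabolicCylinder (hp : 1 < p) {z w : SpaceTime n} {r : ℝ} (hr : 0 < r) :
    w ∈ parabolicCylinder p z r ↔ ‖w.1 - z.1‖ < r ∧ |w.2 - z.2| < r ^ p := by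
  simp only [parabolicCylinder, parabolicDist, mem_ofPred_eq, max_lt_iff, one_div]
  rw [Real.rpow_inv_lt_iff_of_pos (abs_nonneg _) hr.le (by linarith)]

lemma parabolicCylinder_eq_prod (hp : 1 < p) (z : SpaceTime n) {r : ℝ} (hr : 0 < r) :
    parabolicCylinder p z r
      = Metric.ball z.1 r ×ˢ Ioo (z.2 - r ^ p) (z.2 + r ^ p) := by
  ext w
  rw [mem_parabolicCylinder hp hr, mem_prod, mem_ball_iff_norm, mem_Ioo, abs_lt]
  constructor <;> rintro ⟨h1, h2, h3⟩ <;> exact ⟨h1, by linarith, by linarith⟩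

lemma isOpen_parabolicCylinder (hp : 1 < p) (z : SpaceTime n) {r : ℝ} (hr : 0 < r) :
    IsOpen (parabolicCylinder p z r) := by
  rw [parabolicCylinder_eq_prod hp z hr]
  exact Metric.isOpen_ball.prod isOpen_Ioo

lemma measurableSet_parabolicCylinder (hp : 1 < p) (z : SpaceTime n) {r : ℝ} (hr : 0 < r) :
    MeasurableSet (parabolicCylinder p z r) :=
  (isOpen_parabolicCylinder hp z hr).measurableSet

lemma parabolicDist_self (hp : 1 < p) (z : SpaceTime n) : parabolicDist p z z = 0 := by
  have : p⁻¹ ≠ 0 := inv_ne_zero (by linarith)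
  simp [parabolicDist, Real.zero_rpow this]

lemma self_mem_parabolicCylinder (hp : 1 < p) (z : SpaceTime n) {r : ℝ} (hr : 0 < r) :
    z ∈ parabolicCylinder p z r := by
  simpa [parabolicCylinder, parabolicDist_self hp z] using hr

lemma parabolicDist_comm (z w : SpaceTime n) : parabolicDist p z w = parabolicDist p w z := by
  simp only [parabolicDist]
  rw [norm_sub_rev, abs_sub_comm]

lemma parabolicDist_triangle (hp : 1 < p) (z w v : SpaceTime n) :
    parabolicDist p z v ≤ parabolicDist p z w + parabolicDist p w v := by
  have hp0 : 0 ≤ 1 / p := by positivity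
  have hp1 : 1 / p ≤ 1 := by rw [div_le_one (by linarith)]; exact hp.le
  have h1 : ‖z.1 - v.1‖ ≤ ‖z.1 - w.1‖ + ‖w.1 - v.1‖ := norm_sub_le_norm_sub_add_norm_sub _ _ _
  have h2 : |z.2 - v.2| ^ (1 / p) ≤ |z.2 - w.2| ^ (1 / p) + |w.2 - v.2| ^ (1 / p) :=
    (Real.rpow_le_rpow (abs_nonneg _) (abs_sub_le z.2 w.2 v.2) hp0).trans
      (Real.rpow_add_le_add_rpow (abs_nonneg _) (abs_nonneg _) hp0 hp1)
  simp only [parabolicDist]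
  refine max_le ?_ ?_
  · exact h1.trans (add_le_add (le_max_left _ _) (le_max_left _ _))
  · exact h2.trans (add_le_add (le_max_right _ _) (le_max_right _ _))

lemma parabolicDist_le_iff (hp : 1 < p) {z w : SpaceTime n} {r : ℝ} (hr : 0 ≤ r) :
    parabolicDist p z w ≤ r ↔ ‖z.1 - w.1‖ ≤ r ∧ |z.2 - w.2| ≤ r ^ p := by
  simp only [parabolicDist, max_le_iff, one_div]
  rw [Real.rpow_inv_le_iff_of_pos (abs_nonneg _) hr (by linarith)]

lemma parabolicCylinder_subset (hp : 1 < p) {z w : SpaceTime n} {r s : ℝ}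
    (h : parabolicDist p z w + r ≤ s) :
    parabolicCylinder p z r ⊆ parabolicCylinder p w s := by
  intro v hv
  have hv' : parabolicDist p v z < r := hv
  have := parabolicDist_triangle hp v z w
  show parabolicDist p v w < s
  linarith

lemma parabolicCylinder_mono (z : SpaceTime n) {r s : ℝ} (h : r ≤ s) :
    parabolicCylinder p z r ⊆ parabolicCylinder p z s :=
  fun _ hw => lt_of_lt_of_le hw h

/-- The Lebesgue measure of a parabolic cylinder of radius `r`. -/
noncomputable def cylinderVolume (n : ℕ) (p r : ℝ) : ℝ :=
  2 * volume.real (Metric.ball (0 : EuclideanSpace ℝ (Fin n)) 1) * r ^ ((n : ℝ) + p)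

lemma volume_real_ball_pos (n : ℕ) :
    0 < volume.real (Metric.ball (0 : EuclideanSpace ℝ (Fin n)) 1) :=
  ENNReal.toReal_pos (Metric.measure_ball_pos _ _ one_pos).ne' Metric.isBounded_ball.measure_lt_top.ne

lemma cylinderVolume_pos {r : ℝ} (hr : 0 < r) : 0 < cylinderVolume n p r := by
  have := volume_real_ball_pos n
  unfold cylinderVolume
  positivity

lemma cylinderVolume_mul {c r : ℝ} (hc : 0 ≤ c) (hr : 0 ≤ r) :
    cylinderVolume n p (c * r) = c ^ ((n : ℝ) + p) * cylinderVolume n p r := by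
  unfold cylinderVolume
  rw [Real.mul_rpow hc hr]
  ring

lemma volume_ball_prod_Ioo (x : EuclideanSpace ℝ (Fin n)) {r : ℝ} (hr : 0 < r) (s t : ℝ) :
    volume (Metric.ball x r ×ˢ Ioo s t)
      = ENNReal.ofReal (volume.real (Metric.ball (0 : EuclideanSpace ℝ (Fin n)) 1) * r ^ n
          * (t - s)) := by
  rw [Measure.volume_eq_prod, Measure.prod_prod, Measure.addHaar_ball_of_pos _ _ hr,
    Real.volume_Ioo, finrank_euclideanSpace_fin, measureReal_def,
    ENNReal.ofReal_mul (by positivity), ENNReal.ofReal_mul (by positivity), ENNReal.ofReal_toReal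
      Metric.isBounded_ball.measure_lt_top.ne]
  ring

lemma volume_parabolicCylinder (hp : 1 < p) (z : SpaceTime n) {r : ℝ} (hr : 0 < r) :
    volume (parabolicCylinder p z r) = ENNReal.ofReal (cylinderVolume n p r) := by
  rw [parabolicCylinder_eq_prod hp z hr, volume_ball_prod_Ioo _ hr, cylinderVolume,
    Real.rpow_add hr, Real.rpow_natCast]
  congr 1
  ring

lemma parabolicDist_timeShift (hp : 1 < p) (z : SpaceTime n) {b r : ℝ} (hb : 0 ≤ b)
    (hr : 0 ≤ r) :
    parabolicDist p (timeShift z (-(b * r ^ p))) z ≤ b ^ (1 / p) * r := by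
  rw [parabolicDist_le_iff hp (by positivity)]
  have h : |(timeShift z (-(b * r ^ p))).2 - z.2| = b * r ^ p := by
    simp only [timeShift, add_sub_cancel_left, abs_neg]
    exact abs_of_nonneg (by positivity)
  refine ⟨by simp only [timeShift, sub_self, norm_zero]; positivity, ?_⟩
  rw [h, Real.mul_rpow (by positivity) hr, ← Real.rpow_mul hb, one_div,
    inv_mul_cancel₀ (by linarith), Real.rpow_one]

/-- Vitali covering by parabolic cylinders of bounded radii. -/
lemma exists_disjoint_parabolicCylinder_cover (hp : 1 < p) (E : Set (SpaceTime n))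
    (r : SpaceTime n → ℝ) (R : ℝ) (hr : ∀ z ∈ E, 0 < r z ∧ r z ≤ R) :
    ∃ I ⊆ E, I.Countable ∧ I.PairwiseDisjoint (fun z => parabolicCylinder p z (r z)) ∧
      E ⊆ ⋃ z ∈ I, parabolicCylinder p z (3 * r z) := by
  -- Selected cylinders have at least half the radius of those they meet. Only the center `z` has to
  -- be covered, so its distance to the selected center is below `r z + r w ≤ 3 * r w`.
  obtain ⟨I, hIE, hdis, hcov⟩ := Vitali.exists_disjoint_subfamily_covering_enlargement
    (fun z : SpaceTime n => parabolicCylinder p z (r z)) E r 2 one_lt_two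
    (fun z hz => (hr z hz).1.le) R (fun z hz => (hr z hz).2)
    (fun z hz => ⟨z, self_mem_parabolicCylinder hp z (hr z hz).1⟩)
  refine ⟨I, hIE, hdis.countable_of_isOpen
    (fun z hz => isOpen_parabolicCylinder hp z (hr z (hIE hz)).1)
    (fun z hz => ⟨z, self_mem_parabolicCylinder hp z (hr z (hIE hz)).1⟩), hdis, ?_⟩
  intro z hz
  obtain ⟨w, hw, ⟨v, hv1, hv2⟩, hle⟩ := hcov z hz
  refine mem_iUnion₂.2 ⟨w, hw, ?_⟩
  have h1 : parabolicDist p v z < r z := hv1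
  have h2 : parabolicDist p v w < r w := hv2
  have h3 := parabolicDist_triangle hp z v w
  rw [parabolicDist_comm z v] at h3
  show parabolicDist p z w < 3 * r w
  linarith

/-- Arbitrarily small cylinders around a point of an open set are contained in the set. -/
lemma exists_parabolicCylinder_subset (hp : 1 < p) {U : Set (SpaceTime n)} (hU : IsOpen U)
    {z : SpaceTime n} (hz : z ∈ U) : ∃ r₀ > 0, parabolicCylinder p z r₀ ⊆ U := by
  obtain ⟨ε, hε, hsub⟩ := Metric.isOpen_iff.1 hU z hz
  refine ⟨min ε (ε ^ (1 / p)), by positivity, ?_⟩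
  intro w hw
  rw [mem_parabolicCylinder hp (by positivity)] at hw
  apply hsub
  rw [Metric.mem_ball, Prod.dist_eq, max_lt_iff, dist_eq_norm, Real.dist_eq]
  refine ⟨hw.1.trans_le (min_le_left _ _), hw.2.trans_le ?_⟩
  calc (min ε (ε ^ (1 / p))) ^ p ≤ (ε ^ (1 / p)) ^ p :=
        Real.rpow_le_rpow (by positivity) (min_le_right _ _) (by linarith)
    _ = ε := by rw [← Real.rpow_mul hε.le, one_div, inv_mul_cancel₀ (by linarith), Real.rpow_one]

/-- A disjoint family of measurable sets meets any set in total measure at most its measure. -/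
lemma tsum_measure_inter_le {α ι : Type*} [MeasurableSpace α] (μ : Measure α) (S : Set α)
    {I : Set ι} (hI : I.Countable) (B : ι → Set α) (hB : ∀ i ∈ I, MeasurableSet (B i))
    (hd : I.PairwiseDisjoint B) : ∑' i : I, μ (S ∩ B i) ≤ μ S := by
  have h1 : ∀ i : I, μ (S ∩ B i) = (μ.restrict S) (B i) := fun i => by
    rw [Measure.restrict_apply (hB i i.2), inter_comm]
  simp_rw [h1]
  rw [← measure_biUnion hI hd hB]
  exact (measure_mono (subset_univ _)).trans (by rw [Measure.restrict_apply_univ])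

/-- A set of finite measure that has small density in small cylinders around each of its points
is a null set. -/
lemma measure_eq_zero_of_small_density (hp : 1 < p) {E : Set (SpaceTime n)}
    (hE : volume E ≠ ∞) {η : ℝ} (hη : 3 ^ ((n : ℝ) + p) * η ≤ 1 / 2) {ρ : ℕ → ℝ}
    (hρ : ∀ k, 0 < ρ k) (hlim : Filter.Tendsto ρ Filter.atTop (nhds 0))
    (h : ∀ w ∈ E, ∀ k, volume (E ∩ parabolicCylinder p w (ρ k))
      ≤ ENNReal.ofReal (η * cylinderVolume n p (ρ k))) : volume E = 0 := by
  by_contra h0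
  -- A substitute for the density theorem that needs no measurability of `E`: cover `E` inside an
  -- open set of less than twice its measure. Disjoint cylinders of a third of the radius lie in
  -- `U`, and the small density on their triples bounds the measure of `E` by half that of `U`.
  obtain ⟨U, hEU, hU, hUlt⟩ := E.exists_isOpen_lt_of_lt (2 * volume E) (by
    rw [two_mul]
    exact ENNReal.lt_add_right hE h0)
  have hk : ∀ w ∈ E, ∃ k, ρ k ≤ 1 ∧ parabolicCylinder p w (ρ k) ⊆ U := by
    intro w hw
    obtain ⟨r₀, hr₀, hsub⟩ := exists_parabolicCylinder_subset hp hU (hEU hw)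
    obtain ⟨k, hk⟩ := (hlim.eventually (gt_mem_nhds (lt_min hr₀ one_pos))).exists
    exact ⟨k, (hk.le.trans (min_le_right _ _)),
      (parabolicCylinder_mono w (hk.le.trans (min_le_left _ _))).trans hsub⟩
  choose! k hk1 hk2 using hk
  obtain ⟨I, hIE, hI, hd, hcov⟩ := exists_disjoint_parabolicCylinder_cover hp E
    (fun w => ρ (k w) / 3) 1 (fun w hw => ⟨by have := hρ (k w); positivity,
      by have := hρ (k w); linarith [hk1 w hw]⟩)
  have hB : ∀ w ∈ I, MeasurableSet (parabolicCylinder p w (ρ (k w) / 3)) := fun w _ =>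
    measurableSet_parabolicCylinder hp w (by have := hρ (k w); positivity)
  have hEle : volume E ≤ ENNReal.ofReal (1 / 2) * volume U := by
    calc volume E ≤ volume (⋃ w ∈ I, E ∩ parabolicCylinder p w (ρ (k w))) := by
          refine measure_mono fun w hw => ?_
          obtain ⟨v, hv, hwv⟩ := mem_iUnion₂.1 (hcov hw)
          rw [mul_div_cancel₀ _ (by norm_num : (3 : ℝ) ≠ 0)] at hwv
          exact mem_iUnion₂.2 ⟨v, hv, hw, hwv⟩
      _ ≤ ∑' w : I, volume (E ∩ parabolicCylinder p (w : SpaceTime n) (ρ (k w))) :=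
          measure_biUnion_le _ hI _
      _ ≤ ∑' w : I, ENNReal.ofReal (1 / 2) *
            volume (U ∩ parabolicCylinder p (w : SpaceTime n) (ρ (k w) / 3)) := by
          refine ENNReal.tsum_le_tsum fun w => (h w (hIE w.2) _).trans ?_
          have hpos := hρ (k w)
          rw [inter_eq_right.2 ((parabolicCylinder_mono _ (by linarith)).trans (hk2 w (hIE w.2))),
            volume_parabolicCylinder hp _ (by positivity), ← ENNReal.ofReal_mul (by norm_num)]
          refine ENNReal.ofReal_le_ofReal ?_
          have hm : cylinderVolume n p (ρ (k w))
              = 3 ^ ((n : ℝ) + p) * cylinderVolume n p (ρ (k w) / 3) := by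
            rw [← cylinderVolume_mul (by norm_num) (by positivity)]
            congr 1
            ring
          have hv : 0 < cylinderVolume n p (ρ (k w) / 3) := cylinderVolume_pos (by positivity)
          rw [hm]
          nlinarith
      _ ≤ ENNReal.ofReal (1 / 2) * volume U := by
          rw [ENNReal.tsum_mul_left]
          gcongr
          exact tsum_measure_inter_le volume U hI _ hB hd
  have : volume E < volume E := by
    calc volume E ≤ ENNReal.ofReal (1 / 2) * volume U := hEle
      _ < ENNReal.ofReal (1 / 2) * (2 * volume E) :=
          (ENNReal.mul_lt_mul_iff_right (by simp) (by simp)).2 hUlt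
      _ = volume E := by
          have h2 : ENNReal.ofReal (1 / 2) * 2 = 1 := by
            rw [one_div, ENNReal.ofReal_inv_of_pos two_pos, ENNReal.ofReal_ofNat]
            exact ENNReal.inv_mul_cancel two_ne_zero ENNReal.ofNat_ne_top
          rw [← mul_assoc, h2, one_mul]
  exact lt_irrefl _ this

/-- The two exceptional sets are too small to cover `C`, so some point of `C` has `u - 1 ≤ f ≤ v +
1`. Every comparison between cylinders below is an instance of this. -/
lemma le_add_two_of_overlap {α : Type*} [MeasurableSpace α] (μ : Measure α) {f : α → ℝ}
    {A B C : Set α} {u v x y : ℝ} (hx : 0 ≤ x) (hy : 0 ≤ y)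
    (hA : μ {w ∈ A | f w < u - 1} ≤ ENNReal.ofReal x)
    (hB : μ {w ∈ B | v + 1 < f w} ≤ ENNReal.ofReal y) (hCA : C ⊆ A) (hCB : C ⊆ B)
    (hC : ENNReal.ofReal (x + y) < μ C) : u ≤ v + 2 := by
  by_contra hlt
  push Not at hlt
  have hsub : C ⊆ {w ∈ A | f w < u - 1} ∪ {w ∈ B | v + 1 < f w} := by
    intro w hw
    by_cases h : f w < u - 1
    · exact Or.inl ⟨hCA hw, h⟩
    · exact Or.inr ⟨hCB hw, by linarith⟩
  have := (measure_mono (μ := μ) hsub).trans (measure_union_le _ _)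
  rw [ENNReal.ofReal_add hx hy] at hC
  exact absurd (hC.trans_le (this.trans (add_le_add hA hB))) (lt_irrefl _)

end Geometry

/-! ### A John-Nirenberg inequality from the weak oscillation condition. -/

section JohnNirenberg

variable {n : ℕ} {p : ℝ}

/-- A weak form of the parabolic oscillation condition: outside of a set of relative measure `η`,
`f ≤ u z r + 1` on the cylinder `B(z, r)` and `f ≥ u z r - 1` on the cylinder `B(z, r) - 2ar^p`. -/
def HasWeakOsc (p a N η : ℝ) (Ω : Set (SpaceTime n)) (f : SpaceTime n → ℝ)
    (u : SpaceTime n → ℝ → ℝ) : Prop :=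
  ∀ z r, 0 < r → parabolicCylinder p z (N * r) ⊆ Ω →
    volume {w ∈ parabolicCylinder p z r | u z r + 1 < f w}
      ≤ ENNReal.ofReal (η * cylinderVolume n p r) ∧
    volume {w ∈ parabolicCylinder p (timeShift z (-(2 * a * r ^ p))) r | f w < u z r - 1}
      ≤ ENNReal.ofReal (η * cylinderVolume n p r)

/-- The measure of the superlevel sets decays exponentially. -/
lemma HasWeakOsc.volume_superlevel_le (hp : 1 < p) {a N L η : ℝ} (ha : 0 ≤ a) (hN : 1 ≤ N)
    (hL : 6 * ((2 * a) ^ (1 / p) + 1) ≤ L) (hη0 : 0 < η)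
    (hη : 4 * (L ^ ((n : ℝ) + p) + 1) * η ≤ 1) {Ω : Set (SpaceTime n)} {f : SpaceTime n → ℝ}
    {u : SpaceTime n → ℝ → ℝ} (hW : HasWeakOsc p a N η Ω f u) (m : ℕ) :
    ∀ z r, 0 < r → parabolicCylinder p z (N * r) ⊆ Ω →
      volume {w ∈ parabolicCylinder p z (r / 2) | u z r + 3 * m < f w}
        ≤ ENNReal.ofReal ((1 / 2) ^ m * cylinderVolume n p r) := by
  set K := (2 * a) ^ (1 / p) with hKdef
  have hK : 0 ≤ K := by positivity
  have hL6 : 6 ≤ L := by linarith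
  set D := L ^ ((n : ℝ) + p) with hDdef
  have hd : 0 ≤ (n : ℝ) + p := by positivity
  have hD1 : 1 ≤ D := Real.one_le_rpow (by linarith) hd
  -- The induction hypothesis must cover all cylinders at once, because it is applied to stopping
  -- cylinders with other centers. Each level costs 3: at most 2 for the value at the stopping
  -- cylinder, plus 1 of slack.
  induction m with
  | zero =>
    intro z r hr _
    rw [pow_zero, one_mul, ← volume_parabolicCylinder hp z hr]
    exact measure_mono fun w hw => parabolicCylinder_mono z (by linarith) hw.1
  | succ m ih =>
    intro z r hr hz
    set E := {w ∈ parabolicCylinder p z (r / 2) | u z r + 3 * ((m + 1 : ℕ) : ℝ) < f w} with hEdef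
    set ρ : ℕ → ℝ := fun k => r / L ^ (k + 1) with hρdef
    have hρ : ∀ k, 0 < ρ k := fun k => by positivity
    have hρs : ∀ k, ρ k = L * ρ (k + 1) := fun k => by
      simp only [hρdef, pow_succ]
      field_simp
    have hρr : ∀ k, L * ρ k ≤ r := by
      intro k
      have : L * ρ k = r / L ^ k := by
        simp only [hρdef, pow_succ]
        field_simp
      rw [this]
      exact div_le_self hr.le (one_le_pow₀ (by linarith))
    have hV : ∀ s, 0 < s → 0 < cylinderVolume n p s := fun s hs => cylinderVolume_pos hs
    -- small cylinders around points of `E` are admissible and lie in the given cylinder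
    have hadm : ∀ w ∈ E, ∀ k, parabolicCylinder p w (N * ρ k) ⊆ Ω := by
      intro w hw k
      refine (parabolicCylinder_subset hp (w := z) (s := N * r) ?_).trans hz
      have h1 : parabolicDist p w z < r / 2 := hw.1
      have h2 := hρr k
      have h3 : 6 * ρ k ≤ r := by nlinarith [hρ k]
      nlinarith
    have hup : ∀ w ∈ E, ∀ k, parabolicCylinder p w (ρ k) ⊆ parabolicCylinder p z r := by
      intro w hw k
      refine parabolicCylinder_subset hp ?_
      have h1 : parabolicDist p w z < r / 2 := hw.1
      have h2 := hρr k
      have h3 : 6 * ρ k ≤ r := by nlinarith [hρ k]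
      linarith [hρ k]
    have hshift : ∀ (w : SpaceTime n) k,
        parabolicDist p (timeShift w (-(2 * a * ρ k ^ p))) w ≤ K * ρ k :=
      fun w k => parabolicDist_timeShift hp w (by positivity) (hρ k).le
    have hlow : ∀ w ∈ E, ∀ k, parabolicCylinder p (timeShift w (-(2 * a * ρ k ^ p))) (ρ k)
        ⊆ parabolicCylinder p z r := by
      intro w hw k
      refine parabolicCylinder_subset hp ?_
      have h1 : parabolicDist p w z < r / 2 := hw.1
      have h2 := hρr k
      have h3 : 6 * (K + 1) * ρ k ≤ r := by nlinarith [hρ k]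
      have h4 := parabolicDist_triangle hp (timeShift w (-(2 * a * ρ k ^ p))) w z
      have h5 := hshift w k
      nlinarith [hρ k]
    -- The lower part of the first small cylinder lies in the given one and takes up the share `1 /
    -- D` of its volume, more than the exceptional sets. Thus the stopping index below is never 0
    -- and has a predecessor.
    have hfirst : ∀ w ∈ E, u w (ρ 0) ≤ u z r + 2 := by
      intro w hw
      have hVr : cylinderVolume n p r = D * cylinderVolume n p (ρ 0) := by
        rw [← cylinderVolume_mul (by linarith) (hρ 0).le]
        congr 1
        simp only [hρdef]
        field_simp
        simp
      have h0 := hV _ (hρ 0)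
      refine le_add_two_of_overlap volume (by positivity) (by have := hV r hr; positivity)
        (hW w (ρ 0) (hρ 0) (hadm w hw 0)).2 (hW z r hr hz).1 subset_rfl (hlow w hw 0) ?_
      rw [volume_parabolicCylinder hp _ (hρ 0), hVr]
      rw [ENNReal.ofReal_lt_ofReal_iff h0]
      nlinarith
    -- the part of `E` where no small cylinder is high is a null set
    set E₁ := {w ∈ E | ∃ k, u z r + 2 < u w (ρ k)} with hE₁def
    have hE₂ : volume (E \ E₁) = 0 := by
      refine measure_eq_zero_of_small_density hp (η := η) (ρ := ρ) ?_ ?_ hρ ?_ ?_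
      · refine ((measure_mono ?_).trans_lt (measure_lt_top_of_subset (t := parabolicCylinder p z r)
          subset_rfl ?_).lt_top).ne
        · exact fun w hw => parabolicCylinder_mono z (by linarith) hw.1.1
        · rw [volume_parabolicCylinder hp z hr]
          exact ENNReal.ofReal_ne_top
      · have : (3 : ℝ) ^ ((n : ℝ) + p) ≤ D := Real.rpow_le_rpow (by norm_num) (by linarith) hd
        nlinarith
      · have h1 := tendsto_pow_atTop_nhds_zero_of_lt_one (r := L⁻¹) (by positivity)
          (inv_lt_one_of_one_lt₀ (by linarith))
        have h2 := ((Filter.tendsto_add_atTop_iff_nat 1).2 h1).const_mul r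
        simpa [hρdef, div_eq_mul_inv] using h2
      -- Off `E₁` one has `u w (ρ k) + 1 ≤ u z r + 3`, and `f` exceeds the latter on `E`. So this
      -- part of `E` falls into the exceptional set of every small cylinder.
      · intro w hw k
        refine (measure_mono ?_).trans (hW w (ρ k) (hρ k) (hadm w hw.1 k)).1
        rintro v ⟨⟨hvE, hv1⟩, hvB⟩
        refine ⟨hvB, ?_⟩
        have h1 : u w (ρ k) ≤ u z r + 2 := by
          by_contra hlt
          exact hw.2 ⟨hw.1, k, by linarith⟩
        have h2 := hvE.2
        push_cast at h2
        have h3 : (0 : ℝ) ≤ m := Nat.cast_nonneg m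
        linarith
    -- the largest high cylinders
    have hlargest : ∀ w ∈ E₁, ∃ k, u w (ρ k) ≤ u z r + 2 ∧ u z r + 2 < u w (ρ (k + 1)) := by
      classical
      rintro w ⟨hwE, hex⟩
      obtain ⟨j, hj⟩ : ∃ j, Nat.find hex = j := ⟨_, rfl⟩
      have hjs := Nat.find_spec hex
      rw [hj] at hjs
      cases j with
      | zero => exact absurd (hfirst w hwE) (not_le.2 hjs)
      | succ k =>
        refine ⟨k, ?_, hjs⟩
        have := Nat.find_min hex (m := k) (by omega)
        exact not_lt.1 this
    choose! k hk1 hk2 using hlargest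
    set σ : SpaceTime n → ℝ := fun w => ρ (k w + 1) with hσdef
    have hσ : ∀ w, 0 < σ w := fun w => hρ _
    have hσρ : ∀ w, ρ (k w) = L * σ w := fun w => hρs _
    -- Radius `(K + 1) * σ` contains the lower part of the stopping cylinder, so these lower parts
    -- are disjoint. The tripled radius is at most `L * σ w / 2 = ρ (k w) / 2`, where the induction
    -- hypothesis applies.
    obtain ⟨I, hIE, hI, hdis, hcov⟩ := exists_disjoint_parabolicCylinder_cover hp E₁
      (fun w => (K + 1) * σ w) r (fun w hw => ⟨by have := hσ w; positivity, by
        have := hρr (k w + 1)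
        nlinarith [hσ w]⟩)
    set F := {w ∈ parabolicCylinder p z r | u z r + 1 < f w} with hFdef
    have hF : volume F ≤ ENNReal.ofReal (η * cylinderVolume n p r) := (hW z r hr hz).1
    set B : SpaceTime n → Set (SpaceTime n) := fun w =>
      parabolicCylinder p (timeShift w (-(2 * a * σ w ^ p))) (σ w) with hBdef
    have hBsub : ∀ w, B w ⊆ parabolicCylinder p w ((K + 1) * σ w) := fun w =>
      parabolicCylinder_subset hp (by
        have : parabolicDist p (timeShift w (-(2 * a * σ w ^ p))) w ≤ K * σ w := hshift w (k w + 1)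
        linarith)
    have hBdis : I.PairwiseDisjoint B := fun v hv w hw hne =>
      (hdis hv hw hne).mono (hBsub v) (hBsub w)
    have hBmeas : ∀ w ∈ I, MeasurableSet (B w) := fun w _ =>
      measurableSet_parabolicCylinder hp _ (hσ w)
    have hη4 : η ≤ 1 / 4 := by nlinarith
    -- A high value at the stopping cylinder forces `f > u z r + 1` on most of its lower part, which
    -- therefore lies mostly in `F`. Since `F` has relative measure at most `η`, the total volume of
    -- the stopping cylinders is small.
    have hBF : ∀ w ∈ I, ENNReal.ofReal ((1 - η) * cylinderVolume n p (σ w))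
        ≤ volume (F ∩ B w) := by
      intro w hw
      have hwE := hIE hw
      have h1 : B w ⊆ (F ∩ B w) ∪ {v ∈ B w | f v < u w (σ w) - 1} := by
        intro v hv
        by_cases hfv : f v < u w (σ w) - 1
        · exact Or.inr ⟨hv, hfv⟩
        · have := hk2 w hwE
          refine Or.inl ⟨⟨hlow w hwE.1 _ hv, ?_⟩, hv⟩
          change u z r + 2 < u w (σ w) at this
          linarith
      have h2 := (measure_mono (μ := volume) h1).trans (measure_union_le _ _)
      have h3 := (hW w (σ w) (hσ w) (hadm w hwE.1 _)).2
      have hv := hV _ (hσ w)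
      rw [show volume (B w) = _ from volume_parabolicCylinder hp _ (hσ w)] at h2
      have h4 := h2.trans (add_le_add_right h3 _)
      rw [show cylinderVolume n p (σ w) = (1 - η) * cylinderVolume n p (σ w)
        + η * cylinderVolume n p (σ w) by ring, ENNReal.ofReal_add
          (mul_nonneg (by linarith) hv.le) (by positivity)] at h4
      refine (ENNReal.add_le_add_iff_right ENNReal.ofReal_ne_top).1 (h4.trans_eq ?_)
      congr 2
      ring
    -- The predecessor of the stopping cylinder is not high, and `u w (ρ (k w)) + 3 * m ≤ u z r + 3
    -- * m + 2` leaves room for the hypothesis at level `m`.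
    have hpiece : ∀ w ∈ I, volume (E ∩ parabolicCylinder p w (ρ (k w) / 2))
        ≤ ENNReal.ofReal ((1 / 2) ^ m * (D / (1 - η))) * volume (F ∩ B w) := by
      intro w hw
      have hwE := hIE hw
      have hv := hV _ (hσ w)
      calc volume (E ∩ parabolicCylinder p w (ρ (k w) / 2))
          ≤ volume {v ∈ parabolicCylinder p w (ρ (k w) / 2) | u w (ρ (k w)) + 3 * m < f v} := by
            refine measure_mono fun v hv => ⟨hv.2, ?_⟩
            have h1 := hk1 w hwE
            have h2 := hv.1.2
            push_cast at h2
            linarith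
        _ ≤ ENNReal.ofReal ((1 / 2) ^ m * cylinderVolume n p (ρ (k w))) :=
            ih w _ (hρ _) (hadm w hwE.1 _)
        _ = ENNReal.ofReal ((1 / 2) ^ m * (D / (1 - η)))
              * ENNReal.ofReal ((1 - η) * cylinderVolume n p (σ w)) := by
            have : 0 < 1 - η := by linarith
            rw [← ENNReal.ofReal_mul (by positivity), hσρ, cylinderVolume_mul (by linarith)
              (hσ w).le]
            congr 1
            field_simp
            ring_nf
            simp [hDdef]
        _ ≤ _ := by
            gcongr
            exact hBF w hw
    have hE₁ : volume E₁ ≤ ENNReal.ofReal ((1 / 2) ^ m * (D / (1 - η))) * volume F := by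
      calc volume E₁ ≤ volume (⋃ w ∈ I, E ∩ parabolicCylinder p w (ρ (k w) / 2)) := by
            refine measure_mono fun w hw => ?_
            obtain ⟨v, hv, hwv⟩ := mem_iUnion₂.1 (hcov hw)
            refine mem_iUnion₂.2 ⟨v, hv, hw.1, parabolicCylinder_mono v ?_ hwv⟩
            rw [hσρ]
            nlinarith [hσ v]
        _ ≤ ∑' w : I, volume (E ∩ parabolicCylinder p (w : SpaceTime n) (ρ (k w) / 2)) :=
            measure_biUnion_le _ hI _
        _ ≤ ∑' w : I, ENNReal.ofReal ((1 / 2) ^ m * (D / (1 - η))) * volume (F ∩ B w) :=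
            ENNReal.tsum_le_tsum fun w => hpiece w w.2
        _ ≤ _ := by
            rw [ENNReal.tsum_mul_left]
            gcongr
            exact tsum_measure_inter_le volume F hI B hBmeas hBdis
    calc volume E ≤ volume (E₁ ∪ (E \ E₁)) := measure_mono (by rw [union_sdiff_self]; exact
          subset_union_right)
      _ ≤ volume E₁ + volume (E \ E₁) := measure_union_le _ _
      _ ≤ ENNReal.ofReal ((1 / 2) ^ m * (D / (1 - η)))
            * ENNReal.ofReal (η * cylinderVolume n p r) := by
          rw [hE₂, add_zero]
          exact hE₁.trans (by gcongr)
      _ ≤ ENNReal.ofReal ((1 / 2) ^ (m + 1) * cylinderVolume n p r) := by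
          have h1 : 0 < 1 - η := by linarith
          rw [← ENNReal.ofReal_mul (by positivity)]
          refine ENNReal.ofReal_le_ofReal ?_
          have h2 : D / (1 - η) * η ≤ 1 / 2 := by
            rw [div_mul_eq_mul_div, div_le_iff₀ h1]
            nlinarith
          have hv := hV r hr
          calc (1 / 2) ^ m * (D / (1 - η)) * (η * cylinderVolume n p r)
              = (1 / 2) ^ m * cylinderVolume n p r * (D / (1 - η) * η) := by ring
            _ ≤ (1 / 2) ^ m * cylinderVolume n p r * (1 / 2) := by gcongr
            _ = _ := by ring

end JohnNirenberg

/-! ### Chains of cylinders inside a tube. -/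

section Chain

variable {n : ℕ} {p : ℝ}

/-- The open set `B(x, ρ) × (t - bρ^p, t + bρ^p)`, where `z = (x, t)`. -/
def parabolicTube (p b : ℝ) (z : SpaceTime n) (ρ : ℝ) : Set (SpaceTime n) :=
  {w | ‖w.1 - z.1‖ < ρ ∧ |w.2 - z.2| < b * ρ ^ p}

/-- Admissible parameters for chains of cylinders in a tube: cylinders of radius `ερξ` along the
curve `ξ ↦ (x + (1 - ξ)e, S - κρ^pξ^p)`, with ratio `lam` of consecutive radii. -/
structure IsChainScale (p a N a' ε lam κ : ℝ) : Prop where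
  eps_pos : 0 < ε
  one_lt_lam : 1 < lam
  lam_le : lam ≤ 1 + ε / 2
  mul_eq : κ * (lam ^ p - 1) = 2 * a * ε ^ p
  pow_le : (N * ε) ^ p ≤ κ
  kappa_le : κ ≤ (a' - 1) / 2
  shift_le : a * ((1 + (2 * a) ^ (1 / p)) * ε) ^ p ≤ (a' - 1) / 2
  mul_le_one : N * ((1 + (2 * a) ^ (1 / p)) * ε) ≤ 1

/-- With `lam = 1 + ε / 2`, the number `κ` is forced by `mul_eq`. As `lam ^ p - 1 ≥ ε / 2`, it is at
most `4 * a * ε ^ (p - 1)`, which tends to 0 because `p > 1`. The lower bound `pow_le` amounts to `N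
^ p * (lam ^ p - 1) ≤ 2 * a`, so it also holds for small `ε`. -/
lemma exists_isChainScale (hp : 1 < p) {a N a' : ℝ} (ha : 0 < a) (hN : 1 ≤ N) (ha' : 1 < a') :
    ∃ ε lam κ, IsChainScale p a N a' ε lam κ := by
  set K := (2 * a) ^ (1 / p) with hKdef
  have hK : 0 ≤ K := by positivity
  have hp0 : 0 < p := by linarith
  have hc : 0 < (a' - 1) / 2 := by linarith
  have e0 : ∀ᶠ ε : ℝ in nhdsWithin 0 (Ioi 0), 0 < ε := self_mem_nhdsWithin
  have e1 : ∀ᶠ ε : ℝ in nhdsWithin 0 (Ioi 0), 4 * a * ε ^ (p - 1) < (a' - 1) / 2 := by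
    have : ContinuousAt (fun ε : ℝ => 4 * a * ε ^ (p - 1)) 0 :=
      continuousAt_const.mul (Real.continuousAt_rpow_const _ _ (Or.inr (by linarith)))
    have h := this.tendsto
    rw [Real.zero_rpow (by linarith), mul_zero] at h
    exact (h.eventually (gt_mem_nhds hc)).filter_mono nhdsWithin_le_nhds
  have e2 : ∀ᶠ ε : ℝ in nhdsWithin 0 (Ioi 0), N ^ p * ((1 + ε / 2) ^ p - 1) < 2 * a := by
    have h0 : ContinuousAt (fun ε : ℝ => 1 + ε / 2) 0 := by fun_prop
    have : ContinuousAt (fun ε : ℝ => N ^ p * ((1 + ε / 2) ^ p - 1)) 0 :=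
      continuousAt_const.mul ((h0.rpow_const (Or.inr hp0.le)).sub continuousAt_const)
    have h := this.tendsto
    norm_num at h
    exact (h.eventually (gt_mem_nhds (by linarith))).filter_mono nhdsWithin_le_nhds
  have e3 : ∀ᶠ ε : ℝ in nhdsWithin 0 (Ioi 0), a * ((1 + K) * ε) ^ p < (a' - 1) / 2 := by
    have h0 : ContinuousAt (fun ε : ℝ => (1 + K) * ε) 0 := by fun_prop
    have : ContinuousAt (fun ε : ℝ => a * ((1 + K) * ε) ^ p) 0 :=
      continuousAt_const.mul (h0.rpow_const (Or.inr hp0.le))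
    have h := this.tendsto
    rw [mul_zero, Real.zero_rpow hp0.ne', mul_zero] at h
    exact (h.eventually (gt_mem_nhds hc)).filter_mono nhdsWithin_le_nhds
  have e4 : ∀ᶠ ε : ℝ in nhdsWithin 0 (Ioi 0), N * ((1 + K) * ε) < 1 := by
    have : ContinuousAt (fun ε : ℝ => N * ((1 + K) * ε)) 0 := by fun_prop
    have h := this.tendsto
    rw [mul_zero, mul_zero] at h
    exact (h.eventually (gt_mem_nhds one_pos)).filter_mono nhdsWithin_le_nhds
  obtain ⟨ε, h0, h1, h2, h3, h4⟩ := (e0.and (e1.and (e2.and (e3.and e4)))).exists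
  have hl : ε / 2 ≤ (1 + ε / 2) ^ p - 1 := by
    have := Real.self_le_rpow_of_one_le (x := 1 + ε / 2) (by linarith) hp.le
    linarith
  have hl0 : 0 < (1 + ε / 2) ^ p - 1 := by linarith
  have hεp : 0 < ε ^ p := Real.rpow_pos_of_pos h0 p
  refine ⟨ε, 1 + ε / 2, 2 * a * ε ^ p / ((1 + ε / 2) ^ p - 1), h0, by linarith, le_rfl,
    div_mul_cancel₀ _ hl0.ne', ?_, ?_, h3.le, h4.le⟩
  · rw [le_div_iff₀ hl0, Real.mul_rpow (by linarith) h0.le]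
    nlinarith
  · refine le_trans ?_ h1.le
    rw [div_le_iff₀ hl0]
    have : ε ^ p = ε ^ (p - 1) * ε := by
      conv_rhs => rw [← Real.rpow_add_one h0.ne', sub_add_cancel]
    rw [this]
    have h5 : 0 < ε ^ (p - 1) := Real.rpow_pos_of_pos h0 _
    calc 2 * a * (ε ^ (p - 1) * ε) = 4 * a * ε ^ (p - 1) * (ε / 2) := by ring
      _ ≤ _ := by gcongr

variable {a N a' ε lam κ : ℝ}

namespace IsChainScale

lemma eps_le_one (h : IsChainScale p a N a' ε lam κ) (ha : 0 ≤ a) (hN : 1 ≤ N) : ε ≤ 1 := by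
  have h1 : (0 : ℝ) ≤ (2 * a) ^ (1 / p) := by positivity
  have h2 := h.mul_le_one
  have h3 := h.eps_pos
  nlinarith [mul_nonneg h1 h3.le]

lemma mul_eps_le_one (h : IsChainScale p a N a' ε lam κ) (ha : 0 ≤ a) (hN : 1 ≤ N) :
    N * ε ≤ 1 := by
  have h1 : (0 : ℝ) ≤ (2 * a) ^ (1 / p) := by positivity
  have h2 := h.mul_le_one
  have h3 := h.eps_pos
  nlinarith [mul_nonneg (mul_nonneg h1 h3.le) (by linarith : 0 ≤ N)]

lemma kappa_pos (h : IsChainScale p a N a' ε lam κ) (hN : 1 ≤ N) : 0 < κ := by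
  have h3 := h.eps_pos
  exact lt_of_lt_of_le (Real.rpow_pos_of_pos (by positivity) p) h.pow_le

lemma eps_rpow_le (h : IsChainScale p a N a' ε lam κ) (hp : 1 < p) (hN : 1 ≤ N) : ε ^ p ≤ κ := by
  have h3 := h.eps_pos
  exact (Real.rpow_le_rpow h3.le (by nlinarith) (by linarith)).trans h.pow_le

/-- The enlarged cylinder has spatial radius at most `ρ * ξ` and half-height at most `κ * ρ ^ p * ξ
^ p`, which are the gaps left by `hw1` and `hw3` to the lateral and top boundary. This makes all
links of a chain admissible. -/
lemma parabolicCylinder_subset_tube (h : IsChainScale p a N a' ε lam κ) (hp : 1 < p) (ha : 0 ≤ a)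
    (hN : 1 ≤ N) (ha' : 1 < a') {z w : SpaceTime n} {ρ ξ : ℝ} (hρ : 0 < ρ) (hξ : 0 < ξ)
    (hξ1 : ξ ≤ 1) (hw1 : ‖w.1 - z.1‖ ≤ ρ * (1 - ξ)) (hw2 : z.2 ≤ w.2)
    (hw3 : w.2 ≤ z.2 + (a' + 1) * ρ ^ p - κ * ρ ^ p * ξ ^ p) :
    parabolicCylinder p w (N * (ε * ρ * ξ)) ⊆ parabolicTube p (a' + 1) z ρ := by
  intro v hv
  have hε := h.eps_pos
  rw [mem_parabolicCylinder hp (by positivity)] at hv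
  obtain ⟨hv1, hv2⟩ := hv
  have hρp : 0 < ρ ^ p := by positivity
  have hξp : 0 < ξ ^ p := by positivity
  have hξp1 : ξ ^ p ≤ 1 := Real.rpow_le_one hξ.le hξ1 (by linarith)
  have hr : (N * (ε * ρ * ξ)) ^ p ≤ κ * ρ ^ p * ξ ^ p := by
    rw [show N * (ε * ρ * ξ) = N * ε * ρ * ξ by ring, Real.mul_rpow (by positivity) hξ.le,
      Real.mul_rpow (by positivity) hρ.le]
    gcongr
    exact h.pow_le
  constructor
  · have h1 : ‖v.1 - z.1‖ ≤ ‖v.1 - w.1‖ + ‖w.1 - z.1‖ := norm_sub_le_norm_sub_add_norm_sub _ _ _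
    have h2 := h.mul_eps_le_one ha hN
    have h3 : N * (ε * ρ * ξ) ≤ ρ * ξ := by
      calc N * (ε * ρ * ξ) = N * ε * (ρ * ξ) := by ring
        _ ≤ 1 * (ρ * ξ) := by gcongr
        _ = _ := one_mul _
    linarith
  · have hκ : κ * ρ ^ p * ξ ^ p ≤ κ * ρ ^ p := by
      have := h.kappa_pos hN
      exact mul_le_of_le_one_right (by positivity) hξp1
    have hκ2 : κ * ρ ^ p ≤ (a' + 1) * ρ ^ p := by
      have := h.kappa_le
      gcongr
      linarith
    rw [abs_lt] at hv2 ⊢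
    constructor <;> linarith [hv2.1, hv2.2]

end IsChainScale

variable {L η : ℝ} {Ω : Set (SpaceTime n)} {f : SpaceTime n → ℝ} {u : SpaceTime n → ℝ → ℝ}

/-- One step of a chain of cylinders of growing radii. -/
lemma HasWeakOsc.chain_step (hW : HasWeakOsc p a N η Ω f u) (h : IsChainScale p a N a' ε lam κ)
    (hp : 1 < p) (ha : 0 ≤ a) (hN : 1 ≤ N) (ha' : 1 < a')
    (hη0 : 0 < η) (hL : 4 ≤ L) (hη : 4 * (L ^ ((n : ℝ) + p) + 1) * η ≤ 1)
    {z : SpaceTime n} {ρ : ℝ} (hρ : 0 < ρ) (hΩ : parabolicTube p (a' + 1) z ρ ⊆ Ω)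
    {e : EuclideanSpace ℝ (Fin n)} (he : ‖e‖ ≤ ρ) {S : ℝ} (hS1 : z.2 + κ * ρ ^ p ≤ S)
    (hS2 : S ≤ z.2 + (a' + 1) * ρ ^ p) {ξ : ℝ} (hξ : 0 < ξ) (hξ1 : lam * ξ ≤ 1) :
    u (z.1 + (1 - ξ) • e, S - κ * ρ ^ p * ξ ^ p) (ε * ρ * ξ) ≤
      u (z.1 + (1 - lam * ξ) • e, S - κ * ρ ^ p * (lam * ξ) ^ p) (ε * ρ * (lam * ξ)) + 2 := by
  have hε := h.eps_pos
  have hlam := h.one_lt_lam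
  have hκ := h.kappa_pos hN
  have hadm : ∀ ζ, 0 < ζ → ζ ≤ 1 → parabolicCylinder p
      ((z.1 + (1 - ζ) • e, S - κ * ρ ^ p * ζ ^ p) : SpaceTime n) (N * (ε * ρ * ζ)) ⊆ Ω := by
    intro ζ hζ hζ1
    refine (h.parabolicCylinder_subset_tube hp ha hN ha' hρ hζ hζ1 ?_ ?_ ?_).trans hΩ
    · simp only [add_sub_cancel_left, norm_smul, Real.norm_eq_abs]
      rw [abs_of_nonneg (by linarith), mul_comm]
      gcongr
    · have : κ * ρ ^ p * ζ ^ p ≤ κ * ρ ^ p :=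
        mul_le_of_le_one_right (by positivity) (Real.rpow_le_one hζ.le hζ1 (by linarith))
      show z.2 ≤ S - κ * ρ ^ p * ζ ^ p
      linarith
    · show S - κ * ρ ^ p * ζ ^ p ≤ _
      linarith
  have hξ' : ξ ≤ 1 := by nlinarith
  set r := ε * ρ * ξ with hr
  have hr0 : 0 < r := by positivity
  have hr2 : ε * ρ * (lam * ξ) = lam * r := by rw [hr]; ring
  have hadm2 := hadm (lam * ξ) (by positivity) hξ1
  rw [hr2] at hadm2 ⊢
  have hv : 0 < cylinderVolume n p (r / 2) := cylinderVolume_pos (by positivity)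
  -- By `mul_eq` the time drop along the curve equals the lag `2 * a * r ^ p` exactly, and by
  -- `lam_le` the spatial move is at most `r / 2`. So the half-radius cylinder about the next center
  -- lies in the old lower cylinder and in the next one.
  refine le_add_two_of_overlap volume (C := parabolicCylinder p
      ((z.1 + (1 - lam * ξ) • e, S - κ * ρ ^ p * (lam * ξ) ^ p) : SpaceTime n) (r / 2)) ?_ ?_
    (hW _ r hr0 (hadm ξ hξ hξ')).2 (hW _ (lam * r) (by positivity) hadm2).1 ?_
    (parabolicCylinder_mono _ (by nlinarith)) ?_
  · have := cylinderVolume_pos (n := n) (p := p) hr0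
    positivity
  · have := cylinderVolume_pos (n := n) (p := p) (r := lam * r) (by positivity)
    positivity
  · refine parabolicCylinder_subset hp ?_
    suffices hd : parabolicDist p ((z.1 + (1 - lam * ξ) • e,
        S - κ * ρ ^ p * (lam * ξ) ^ p) : SpaceTime n)
        (timeShift ((z.1 + (1 - ξ) • e, S - κ * ρ ^ p * ξ ^ p) : SpaceTime n) (-(2 * a * r ^ p)))
        ≤ r / 2 by linarith
    rw [parabolicDist_le_iff hp (by positivity)]
    simp only [timeShift]
    constructor
    · have h1 : z.1 + (1 - lam * ξ) • e - (z.1 + (1 - ξ) • e) = (-((lam - 1) * ξ)) • e := by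
        module
      rw [h1, norm_smul, Real.norm_eq_abs, abs_neg, abs_of_nonneg (by
        have : 0 ≤ lam - 1 := by linarith
        positivity)]
      have h2 := h.lam_le
      calc (lam - 1) * ξ * ‖e‖ ≤ ε / 2 * ξ * ρ := by gcongr; linarith
        _ = r / 2 := by rw [hr]; ring
    · have h1 : S - κ * ρ ^ p * (lam * ξ) ^ p - (S - κ * ρ ^ p * ξ ^ p + -(2 * a * r ^ p)) = 0 := by
        rw [hr, Real.mul_rpow (by positivity) hξ.le, Real.mul_rpow (by positivity) hξ.le,
          Real.mul_rpow hε.le hρ.le]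
        linear_combination (-(ρ ^ p * ξ ^ p)) * h.mul_eq
      rw [h1, abs_zero]
      positivity
  · rw [volume_parabolicCylinder hp _ (by positivity), ENNReal.ofReal_lt_ofReal_iff hv]
    have hd : 0 ≤ (n : ℝ) + p := by positivity
    have hle : ∀ c, 0 ≤ c → c ≤ 4 →
        cylinderVolume n p (c * (r / 2)) ≤ L ^ ((n : ℝ) + p) * cylinderVolume n p (r / 2) := by
      intro c hc hc4
      rw [cylinderVolume_mul hc (by positivity)]
      gcongr
      linarith
    have h1 := hle 2 (by norm_num) (by norm_num)
    have hl2 := h.lam_le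
    have hl3 := h.eps_le_one ha hN
    have h2 := hle (2 * lam) (by positivity) (by linarith)
    rw [show 2 * (r / 2) = r by ring] at h1
    rw [show 2 * lam * (r / 2) = lam * r by ring] at h2
    nlinarith

/-- Comparison with a cylinder of larger radius whose upper part contains the lower part. -/
lemma HasWeakOsc.time_step (hW : HasWeakOsc p a N η Ω f u) (hp : 1 < p)
    (hη0 : 0 < η) (hL : 0 ≤ L) (hη : 4 * (L ^ ((n : ℝ) + p) + 1) * η ≤ 1)
    {z w : SpaceTime n} {r s : ℝ} (hr : 0 < r) (hrs : r ≤ s) (hs : s ≤ L * r)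
    (hz : parabolicCylinder p z (N * r) ⊆ Ω) (hw : parabolicCylinder p w (N * s) ⊆ Ω)
    (hd : parabolicDist p (timeShift z (-(2 * a * r ^ p))) w + r ≤ s) :
    u z r ≤ u w s + 2 := by
  have hv : 0 < cylinderVolume n p r := cylinderVolume_pos hr
  have hs0 : 0 < s := by linarith
  have hvs := cylinderVolume_pos (n := n) (p := p) hs0
  refine le_add_two_of_overlap volume (by positivity) (by positivity) (hW z r hr hz).2
    (hW w s hs0 hw).1 subset_rfl (parabolicCylinder_subset hp hd) ?_
  rw [volume_parabolicCylinder hp _ hr, ENNReal.ofReal_lt_ofReal_iff hv]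
  have h1 : cylinderVolume n p s ≤ L ^ ((n : ℝ) + p) * cylinderVolume n p r := by
    rw [← cylinderVolume_mul hL hr.le]
    unfold cylinderVolume
    gcongr
  nlinarith

/-- A chain of cylinders of the same radius, straight backward in time. -/
lemma HasWeakOsc.time_chain (hW : HasWeakOsc p a N η Ω f u) (hp : 1 < p) (ha : 0 < a)
    (hη0 : 0 < η) (hL : 1 ≤ L) (hη : 4 * (L ^ ((n : ℝ) + p) + 1) * η ≤ 1)
    {x : EuclideanSpace ℝ (Fin n)} {r t s₀ : ℝ} (hr : 0 < r)
    (hadm : ∀ s, t ≤ s → s ≤ s₀ → parabolicCylinder p ((x, s) : SpaceTime n) (N * r) ⊆ Ω)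
    (k : ℕ) (hk : t ≤ s₀ - k * (2 * a * r ^ p)) :
    u (x, s₀) r ≤ u (x, s₀ - k * (2 * a * r ^ p)) r + 2 * k := by
  have hstep0 : 0 < 2 * a * r ^ p := by positivity
  induction k with
  | zero => simp
  | succ k ih =>
    push_cast at hk ⊢
    have hk0 : 0 ≤ (k : ℝ) * (2 * a * r ^ p) := by positivity
    have h1 := ih (by linarith)
    have h2 := hW.time_step hp hη0 (L := L) (by linarith) hη
      (z := (x, s₀ - k * (2 * a * r ^ p)))
      (w := (x, s₀ - (k + 1) * (2 * a * r ^ p))) hr le_rfl (by nlinarith)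
      (hadm _ (by linarith) (by linarith)) (hadm _ hk (by linarith)) (by
        have : timeShift ((x, s₀ - k * (2 * a * r ^ p)) : SpaceTime n)
            (-(2 * a * r ^ p)) = (x, s₀ - (k + 1) * (2 * a * r ^ p)) := by
          simp only [timeShift]
          congr 1
          ring
        rw [this, parabolicDist_self hp]
        linarith)
    linarith

/-- A chain of cylinders of growing radii, from a point of the tube to its axis. -/
lemma HasWeakOsc.chain_growth (hW : HasWeakOsc p a N η Ω f u)
    (h : IsChainScale p a N a' ε lam κ) (hp : 1 < p) (ha : 0 ≤ a) (hN : 1 ≤ N) (ha' : 1 < a')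
    (hη0 : 0 < η) (hL : 4 ≤ L) (hη : 4 * (L ^ ((n : ℝ) + p) + 1) * η ≤ 1)
    {z : SpaceTime n} {ρ : ℝ} (hρ : 0 < ρ) (hΩ : parabolicTube p (a' + 1) z ρ ⊆ Ω) (m : ℕ)
    {w : SpaceTime n} (hw1 : ‖w.1 - z.1‖ ≤ ρ * (1 - (lam⁻¹) ^ m))
    (hw2 : z.2 + (a' - 1) * ρ ^ p ≤ w.2)
    (hw3 : w.2 ≤ z.2 + (a' + 1) * ρ ^ p - κ * ρ ^ p * ((lam⁻¹) ^ m) ^ p) :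
    ∃ S, z.2 + (a' - 1) * ρ ^ p ≤ S ∧ S ≤ z.2 + (a' + 1) * ρ ^ p ∧
      u w (ε * ρ * (lam⁻¹) ^ m) ≤ u (z.1, S - κ * ρ ^ p) (ε * ρ) + 2 * m := by
  have hp0 : 0 < p := by linarith
  have hε := h.eps_pos
  have hlam := h.one_lt_lam
  have hlam0 : 0 < lam := by linarith
  have hκ := h.kappa_pos hN
  have hκ2 := h.kappa_le
  have hρp : 0 < ρ ^ p := by positivity
  have hξ0 : 0 < (lam⁻¹) ^ m := by positivity
  have hξ1 : (lam⁻¹) ^ m ≤ 1 := pow_le_one₀ (by positivity) (inv_le_one_of_one_le₀ hlam.le)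
  -- `S` and `e` are chosen so that the curve passes through `w` at `ξ = lam⁻¹ ^ m`; it reaches the
  -- axis at `ξ = 1`, at time `S - κ * ρ ^ p`.
  set S := w.2 + κ * ρ ^ p * ((lam⁻¹) ^ m) ^ p with hSdef
  have hSle : S ≤ z.2 + (a' + 1) * ρ ^ p := by rw [hSdef]; linarith
  have hSge : z.2 + (a' - 1) * ρ ^ p ≤ S := by
    have : 0 ≤ κ * ρ ^ p * ((lam⁻¹) ^ m) ^ p := by positivity
    rw [hSdef]
    linarith
  have hκρ : κ * ρ ^ p ≤ (a' - 1) / 2 * ρ ^ p := by gcongr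
  have haρ : 0 < (a' - 1) / 2 * ρ ^ p := mul_pos (by linarith) hρp
  obtain ⟨e, he, hwe⟩ : ∃ e : EuclideanSpace ℝ (Fin n), ‖e‖ ≤ ρ ∧
      w.1 = z.1 + (1 - (lam⁻¹) ^ m) • e := by
    rcases eq_or_lt_of_le hξ1 with h1 | h1
    · refine ⟨0, by simpa using hρ.le, ?_⟩
      rw [h1, sub_self, mul_zero] at hw1
      simpa [sub_eq_zero] using norm_le_zero_iff.1 hw1
    · have h2 : 0 < 1 - (lam⁻¹) ^ m := by linarith
      refine ⟨(1 - (lam⁻¹) ^ m)⁻¹ • (w.1 - z.1), ?_, ?_⟩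
      · rw [norm_smul, norm_inv, Real.norm_eq_abs, abs_of_pos h2, inv_mul_le_iff₀ h2]
        linarith
      · rw [smul_inv_smul₀ h2.ne', add_sub_cancel]
  have hgrow : ∀ j : ℕ,
      u (z.1 + (1 - (lam⁻¹) ^ j) • e, S - κ * ρ ^ p * ((lam⁻¹) ^ j) ^ p) (ε * ρ * (lam⁻¹) ^ j) ≤
        u (z.1, S - κ * ρ ^ p) (ε * ρ) + 2 * j := by
    intro j
    induction j with
    | zero => simp
    | succ j ih =>
      have h1 : lam * (lam⁻¹) ^ (j + 1) = (lam⁻¹) ^ j := by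
        rw [pow_succ, mul_comm, mul_assoc, inv_mul_cancel₀ hlam0.ne', mul_one]
      have h2 := hW.chain_step h hp ha hN ha' hη0 hL hη hρ hΩ he (S := S)
        (by linarith) hSle (ξ := (lam⁻¹) ^ (j + 1)) (by positivity)
        (by rw [h1]; exact pow_le_one₀ (by positivity) (inv_le_one_of_one_le₀ hlam.le))
      rw [h1] at h2
      push_cast
      linarith
  have hw : w = (z.1 + (1 - (lam⁻¹) ^ m) • e, S - κ * ρ ^ p * ((lam⁻¹) ^ m) ^ p) := by
    refine Prod.ext hwe ?_
    simp [hSdef]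
  refine ⟨S, hSge, hSle, ?_⟩
  have hfirst := hgrow m
  rwa [← hw] at hfirst

/-- A chain of cylinders down the axis of a tube. -/
lemma HasWeakOsc.chain_descent (hW : HasWeakOsc p a N η Ω f u)
    (h : IsChainScale p a N a' ε lam κ) (hp : 1 < p) (ha : 0 < a) (hN : 1 ≤ N) (ha' : 1 < a')
    (hη0 : 0 < η) (hL : 6 * ((2 * a) ^ (1 / p) + 1) ≤ L)
    (hη : 4 * (L ^ ((n : ℝ) + p) + 1) * η ≤ 1)
    {z : SpaceTime n} {ρ : ℝ} (hρ : 0 < ρ) (hΩ : parabolicTube p (a' + 1) z ρ ⊆ Ω) {S : ℝ}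
    (hSge : z.2 + (a' - 1) * ρ ^ p ≤ S) (hSle : S ≤ z.2 + (a' + 1) * ρ ^ p) :
    u (z.1, S - κ * ρ ^ p) (ε * ρ) ≤
      u (timeShift z (a * ((1 + (2 * a) ^ (1 / p)) * ε * ρ) ^ p))
        ((1 + (2 * a) ^ (1 / p)) * ε * ρ) + ((a' + 1) / (a * ε ^ p) + 2) := by
  set K := (2 * a) ^ (1 / p) with hKdef
  have hK : 0 ≤ K := by positivity
  have hp0 : 0 < p := by linarith
  have hL6 : 6 ≤ L := by linarith
  have hε := h.eps_pos
  have hκ := h.kappa_pos hN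
  have hκ2 := h.kappa_le
  have hρp : 0 < ρ ^ p := by positivity
  have hεp : 0 < ε ^ p := by positivity
  have hκρ : κ * ρ ^ p ≤ (a' - 1) / 2 * ρ ^ p := by gcongr
  have haρ : 0 < (a' - 1) / 2 * ρ ^ p := mul_pos (by linarith) hρp
  set r := ε * ρ with hrdef
  have hr : 0 < r := by positivity
  have hrp : r ^ p = ε ^ p * ρ ^ p := Real.mul_rpow hε.le hρ.le
  have hstep0 : 0 < 2 * a * r ^ p := by positivity
  have hadm : ∀ s, z.2 ≤ s → s ≤ S - κ * ρ ^ p →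
      parabolicCylinder p ((z.1, s) : SpaceTime n) (N * r) ⊆ Ω := by
    intro s hs1 hs2
    have := h.parabolicCylinder_subset_tube hp ha.le hN ha' (z := z) (w := (z.1, s)) hρ one_pos le_rfl
      (by simp) hs1 (by rw [Real.one_rpow]; show s ≤ _; linarith)
    rw [mul_one] at this
    exact this.trans hΩ
  have hvert : ∀ k : ℕ, z.2 ≤ S - κ * ρ ^ p - k * (2 * a * r ^ p) →
      u (z.1, S - κ * ρ ^ p) r ≤ u (z.1, S - κ * ρ ^ p - k * (2 * a * r ^ p)) r + 2 * k :=
    hW.time_chain hp ha hη0 (by linarith) hη hr hadm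
  set R := (1 + K) * ε * ρ with hRdef
  have hRr : R = (1 + K) * r := by rw [hRdef, hrdef]; ring
  have hR0 : 0 < R := by positivity
  have hRp : a * R ^ p ≤ (a' - 1) / 2 * ρ ^ p := by
    rw [hRdef, Real.mul_rpow (by positivity) hρ.le, ← mul_assoc]
    gcongr
    exact h.shift_le
  have hRp0 : 0 < a * R ^ p := by positivity
  -- After `k` whole steps the target time is less than one step `2 * a * r ^ p = (K * r) ^ p` away.
  -- The last cylinder has radius `R = (1 + K) * r` to absorb this remainder, so its center does not
  -- depend on `S`.
  obtain ⟨k, hk⟩ : ∃ k : ℕ, k = ⌊(S - κ * ρ ^ p - (z.2 + a * R ^ p)) / (2 * a * r ^ p)⌋₊ :=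
    ⟨_, rfl⟩
  have hnn : 0 ≤ (S - κ * ρ ^ p - (z.2 + a * R ^ p)) / (2 * a * r ^ p) :=
    div_nonneg (by linarith) hstep0.le
  have hk1 := Nat.floor_le hnn
  have hk2 := Nat.lt_floor_add_one ((S - κ * ρ ^ p - (z.2 + a * R ^ p)) / (2 * a * r ^ p))
  rw [← hk] at hk1 hk2
  rw [le_div_iff₀ hstep0] at hk1
  rw [div_lt_iff₀ hstep0] at hk2
  have hkle : 2 * (k : ℝ) ≤ (a' + 1) / (a * ε ^ p) := by
    rw [le_div_iff₀ (by positivity)]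
    rw [hrp] at hk1
    have : 2 * (k : ℝ) * (a * ε ^ p) * ρ ^ p ≤ (a' + 1) * ρ ^ p := by
      have : 0 < κ * ρ ^ p := by positivity
      linarith
    exact le_of_mul_le_mul_right this hρp
  have h1 := hvert k (by linarith)
  have hadmR : parabolicCylinder p (timeShift z (a * R ^ p)) (N * R) ⊆ Ω := by
    refine Subset.trans ?_ hΩ
    intro v hv
    rw [mem_parabolicCylinder hp (by positivity)] at hv
    simp only [timeShift] at hv
    have hNR : N * R ≤ ρ := by
      calc N * R = N * ((1 + K) * ε) * ρ := by rw [hRdef]; ring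
        _ ≤ 1 * ρ := by gcongr; exact h.mul_le_one
        _ = ρ := one_mul ρ
    have hNRp : (N * R) ^ p ≤ ρ ^ p := Real.rpow_le_rpow (by positivity) hNR hp0.le
    refine ⟨by linarith [hv.1], ?_⟩
    have h2 := hv.2
    rw [abs_lt] at h2 ⊢
    constructor <;> linarith [h2.1, h2.2]
  have h2 := hW.time_step hp hη0 (L := L) (by linarith) hη
    (z := (z.1, S - κ * ρ ^ p - k * (2 * a * r ^ p))) (w := timeShift z (a * R ^ p))
    (r := r) (s := R) hr (by rw [hRr]; nlinarith) (by rw [hRr]; gcongr; linarith)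
    (hadm _ (by linarith) (by nlinarith [Nat.cast_nonneg (α := ℝ) k])) hadmR (by
      suffices hd : parabolicDist p (timeShift
          ((z.1, S - κ * ρ ^ p - k * (2 * a * r ^ p)) : SpaceTime n) (-(2 * a * r ^ p)))
          (timeShift z (a * R ^ p)) ≤ K * r by linarith
      rw [parabolicDist_le_iff hp (by positivity)]
      simp only [timeShift, sub_self, norm_zero]
      refine ⟨by positivity, ?_⟩
      rw [Real.mul_rpow hK hr.le, hKdef, ← Real.rpow_mul (by positivity), one_div,
        inv_mul_cancel₀ hp0.ne', Real.rpow_one, abs_le]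
      constructor <;> linarith)
  linarith

/-- The central value of a tube controls `u` along the tube, up to a logarithm of the distance to
the boundary. -/
lemma HasWeakOsc.chain_bound (hW : HasWeakOsc p a N η Ω f u) (h : IsChainScale p a N a' ε lam κ)
    (hp : 1 < p) (ha : 0 < a) (hN : 1 ≤ N) (ha' : 1 < a')
    (hη0 : 0 < η) (hL : 6 * ((2 * a) ^ (1 / p) + 1) ≤ L)
    (hη : 4 * (L ^ ((n : ℝ) + p) + 1) * η ≤ 1)
    {z : SpaceTime n} {ρ : ℝ} (hρ : 0 < ρ) (hΩ : parabolicTube p (a' + 1) z ρ ⊆ Ω) (m : ℕ)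
    {w : SpaceTime n} (hw1 : ‖w.1 - z.1‖ ≤ ρ * (1 - (lam⁻¹) ^ m))
    (hw2 : z.2 + (a' - 1) * ρ ^ p ≤ w.2)
    (hw3 : w.2 ≤ z.2 + (a' + 1) * ρ ^ p - κ * ρ ^ p * ((lam⁻¹) ^ m) ^ p) :
    u w (ε * ρ * (lam⁻¹) ^ m) ≤
      u (timeShift z (a * ((1 + (2 * a) ^ (1 / p)) * ε * ρ) ^ p))
        ((1 + (2 * a) ^ (1 / p)) * ε * ρ) + 2 * m + ((a' + 1) / (a * ε ^ p) + 2) := by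
  obtain ⟨S, hS1, hS2, hS⟩ := hW.chain_growth h hp ha.le hN ha' hη0 (by
    have : (0 : ℝ) ≤ (2 * a) ^ (1 / p) := by positivity
    linarith) hη hρ hΩ m hw1 hw2 hw3
  have := hW.chain_descent h hp ha hN ha' hη0 hL hη hρ hΩ hS1 hS2
  linarith

end Chain

/-! ### Integrals of powers from geometric decay. -/

section LayerCake

lemma tsum_ofReal_pow_mul_rpow_ne_top {r A q : ℝ} (hr0 : 0 < r) (hr1 : r < 1) (hA : 0 ≤ A)
    (hq : 0 ≤ q) :
    ∑' m : ℕ, ENNReal.ofReal (r ^ m) * ENNReal.ofReal (A * (m + 1)) ^ q ≠ ∞ := by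
  set k := ⌈q⌉₊
  have h1 : Summable (fun m : ℕ => (m : ℝ) ^ k * r ^ m) :=
    summable_pow_mul_geometric_of_norm_lt_one k (by rwa [Real.norm_eq_abs, abs_of_pos hr0])
  have h2 := ((summable_nat_add_iff 1).2 h1).mul_left (A ^ q * r⁻¹)
  refine ne_top_of_le_ne_top h2.tsum_ofReal_ne_top (ENNReal.tsum_le_tsum fun m => ?_)
  rw [ENNReal.ofReal_rpow_of_nonneg (by positivity) hq, ← ENNReal.ofReal_mul (by positivity)]
  refine ENNReal.ofReal_le_ofReal ?_
  rw [Real.mul_rpow hA (by positivity)]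
  have h3 : ((m : ℝ) + 1) ^ q ≤ ((m : ℝ) + 1) ^ k := by
    rw [← Real.rpow_natCast]
    exact Real.rpow_le_rpow_of_exponent_le (by linarith [Nat.cast_nonneg (α := ℝ) m])
      (Nat.le_ceil q)
  calc r ^ m * (A ^ q * ((m : ℝ) + 1) ^ q) ≤ r ^ m * (A ^ q * ((m : ℝ) + 1) ^ k) := by gcongr
    _ = A ^ q * r⁻¹ * (((m + 1 : ℕ) : ℝ) ^ k * r ^ (m + 1)) := by
        push_cast
        rw [pow_succ r]
        field_simp

lemma ennreal_add_rpow_le {x y : ℝ≥0∞} {q : ℝ} (hq : 0 ≤ q) :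
    (x + y) ^ q ≤ 2 ^ q * (x ^ q + y ^ q) := by
  have h : x + y ≤ 2 * max x y := by
    rw [two_mul]
    exact add_le_add (le_max_left _ _) (le_max_right _ _)
  calc (x + y) ^ q ≤ (2 * max x y) ^ q := ENNReal.rpow_le_rpow h hq
    _ = 2 ^ q * max x y ^ q := ENNReal.mul_rpow_of_nonneg _ _ hq
    _ ≤ 2 ^ q * (x ^ q + y ^ q) := by
        gcongr
        rcases max_cases x y with ⟨h, _⟩ | ⟨h, _⟩ <;> rw [h]
        · exact le_self_add
        · exact le_add_self

/-- Where `3 * m < g ≤ 3 * (m + 1)`, the single indicator term of index `m` already dominates the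
integrand, so no exact layer-cake formula is needed. -/
lemma lintegral_rpow_le_of_tail {α : Type*} [MeasurableSpace α] {μ : Measure α} {B : Set α}
    {g : α → ℝ} (hg : AEMeasurable g (μ.restrict B)) {q : ℝ} (hq : 0 < q) {V : ℝ≥0∞}
    (h : ∀ m : ℕ, μ {w ∈ B | 3 * m < g w} ≤ ENNReal.ofReal ((1 / 2) ^ m) * V) :
    ∫⁻ w in B, ENNReal.ofReal (g w) ^ q ∂μ
      ≤ (∑' m : ℕ, ENNReal.ofReal ((1 / 2) ^ m) * ENNReal.ofReal (3 * (m + 1)) ^ q) * V := by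
  have hnull : ∀ m : ℕ, NullMeasurableSet {w | 3 * (m : ℝ) < g w} (μ.restrict B) := fun m =>
    nullMeasurableSet_lt aemeasurable_const hg
  calc ∫⁻ w in B, ENNReal.ofReal (g w) ^ q ∂μ
      ≤ ∫⁻ w in B, ∑' m : ℕ, {w | 3 * (m : ℝ) < g w}.indicator
          (fun _ => ENNReal.ofReal (3 * (m + 1)) ^ q) w ∂μ := by
        refine lintegral_mono fun w => ?_
        rcases le_or_gt (g w) 0 with h0 | h0
        · rw [ENNReal.ofReal_of_nonpos h0, ENNReal.zero_rpow_of_pos hq]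
          exact zero_le
        · obtain ⟨m, hm⟩ : ∃ m, ⌈g w / 3⌉₊ = m + 1 :=
            Nat.exists_eq_succ_of_ne_zero (Nat.ceil_pos.2 (by positivity)).ne'
          have h1 := Nat.le_ceil (g w / 3)
          have h2 : (m : ℝ) < g w / 3 := Nat.lt_ceil.1 (by omega)
          rw [hm] at h1
          push_cast at h1
          refine le_trans ?_ (ENNReal.le_tsum m)
          rw [indicator_of_mem (show w ∈ {w | 3 * (m : ℝ) < g w} by
            show 3 * (m : ℝ) < g w
            linarith)]
          exact ENNReal.rpow_le_rpow (ENNReal.ofReal_le_ofReal (by linarith)) hq.le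
    _ = ∑' m : ℕ, ∫⁻ w in B, {w | 3 * (m : ℝ) < g w}.indicator
          (fun _ => ENNReal.ofReal (3 * (m + 1)) ^ q) w ∂μ :=
        lintegral_tsum fun m => aemeasurable_const.indicator₀ (hnull m)
    _ ≤ ∑' m : ℕ, ENNReal.ofReal (3 * (m + 1)) ^ q * (ENNReal.ofReal ((1 / 2) ^ m) * V) := by
        refine ENNReal.tsum_le_tsum fun m => (lintegral_indicator_const_le _ _).trans ?_
        gcongr
        rw [Measure.restrict_apply₀ (hnull m)]
        refine le_trans (measure_mono ?_) (h m)
        exact fun w hw => ⟨hw.2, hw.1⟩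
    _ = _ := by
        rw [← ENNReal.tsum_mul_right]
        congr 1
        ext m
        ring

end LayerCake

/-! ### Summation of the bounds over boundary layers of the upper cylinder. -/

section Tube

variable {n : ℕ} {p : ℝ}

/-- The exponential decay of superlevel sets gives integrability of all powers. -/
lemma HasWeakOsc.lintegral_rpow_le (hp : 1 < p) {a N L η : ℝ} (ha : 0 ≤ a) (hN : 1 ≤ N)
    (hL : 6 * ((2 * a) ^ (1 / p) + 1) ≤ L) (hη0 : 0 < η)
    (hη : 4 * (L ^ ((n : ℝ) + p) + 1) * η ≤ 1) {Ω : Set (SpaceTime n)} {f : SpaceTime n → ℝ}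
    {u : SpaceTime n → ℝ → ℝ} (hW : HasWeakOsc p a N η Ω f u)
    (hf : AEMeasurable f (volume.restrict Ω)) {q : ℝ} (hq : 0 < q) {z : SpaceTime n} {r c A : ℝ}
    (hr : 0 < r) (hz : parabolicCylinder p z (N * r) ⊆ Ω) (hc : u z r ≤ c + A) :
    ∫⁻ w in parabolicCylinder p z (r / 2), ENNReal.ofReal (f w - c) ^ q
      ≤ 2 ^ q * ((∑' m : ℕ, ENNReal.ofReal ((1 / 2) ^ m) * ENNReal.ofReal (3 * (m + 1)) ^ q)
          + ENNReal.ofReal A ^ q) * ENNReal.ofReal (cylinderVolume n p r) := by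
  have hsub : parabolicCylinder p z (r / 2) ⊆ Ω :=
    (parabolicCylinder_mono z (by nlinarith)).trans hz
  have hfB : AEMeasurable f (volume.restrict (parabolicCylinder p z (r / 2))) :=
    hf.mono_measure (Measure.restrict_mono_set _ hsub)
  have htail := lintegral_rpow_le_of_tail (V := ENNReal.ofReal (cylinderVolume n p r))
    (hfB.sub_const (u z r)) hq fun m => by
    rw [← ENNReal.ofReal_mul (by positivity)]
    refine le_trans (measure_mono ?_) (hW.volume_superlevel_le hp ha hN hL hη0 hη m z r hr hz)
    exact fun w hw => ⟨hw.1, by have := hw.2; linarith⟩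
  calc ∫⁻ w in parabolicCylinder p z (r / 2), ENNReal.ofReal (f w - c) ^ q
      ≤ ∫⁻ w in parabolicCylinder p z (r / 2),
          2 ^ q * (ENNReal.ofReal (f w - u z r) ^ q + ENNReal.ofReal A ^ q) := by
        refine lintegral_mono fun w => ?_
        refine le_trans (ENNReal.rpow_le_rpow ?_ hq.le) (ennreal_add_rpow_le hq.le)
        exact (ENNReal.ofReal_le_ofReal (by linarith)).trans ENNReal.ofReal_add_le
    _ = 2 ^ q * (∫⁻ w in parabolicCylinder p z (r / 2), ENNReal.ofReal (f w - u z r) ^ q)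
          + 2 ^ q * (ENNReal.ofReal A ^ q * volume (parabolicCylinder p z (r / 2))) := by
        rw [lintegral_const_mul' _ _ (ENNReal.rpow_ne_top_of_nonneg hq.le (by simp)),
          lintegral_add_right _ measurable_const, lintegral_const, Measure.restrict_apply_univ,
          mul_add]
    _ ≤ _ := by
        rw [mul_add, add_mul, mul_assoc, mul_assoc]
        gcongr
        rw [← volume_parabolicCylinder hp z hr]
        exact measure_mono (parabolicCylinder_mono z (by linarith))

/-- Bernoulli's inequality `(1 - X) ^ n ≥ 1 - n * X` bounds the lateral part, and `X ^ p ≤ X` the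
top part. -/
lemma volume_layer_le (hp : 1 < p) {b κ X ρ t : ℝ} (x : EuclideanSpace ℝ (Fin n)) (hρ : 0 < ρ)
    (hκ : 0 ≤ κ) (hκb : κ ≤ b) (hX : 0 < X) (hX1 : X < 1) :
    volume ((Metric.ball x ρ ×ˢ Ioo t (t + b * ρ ^ p)) \
      (Metric.ball x (ρ * (1 - X)) ×ˢ Ioo t (t + b * ρ ^ p - κ * ρ ^ p * X ^ p)))
      ≤ ENNReal.ofReal ((n + 1) * b * X * cylinderVolume n p ρ) := by
  have hρp : 0 < ρ ^ p := by positivity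
  have hXp : X ^ p ≤ X := by
    simpa using Real.rpow_le_rpow_of_exponent_ge hX hX1.le hp.le
  have hXp0 : 0 < X ^ p := by positivity
  have h1X : 0 < ρ * (1 - X) := mul_pos hρ (by linarith)
  have hω := volume_real_ball_pos n
  have hb : 0 ≤ b := hκ.trans hκb
  have hκX : κ * X ^ p ≤ b := by nlinarith
  rw [measure_sdiff ?_ (measurableSet_ball.prod measurableSet_Ioo).nullMeasurableSet ?_,
    volume_ball_prod_Ioo _ hρ, volume_ball_prod_Ioo _ h1X, ← ENNReal.ofReal_sub _ ?_]
  · refine ENNReal.ofReal_le_ofReal ?_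
    rw [cylinderVolume, Real.rpow_add hρ, Real.rpow_natCast, mul_pow]
    have hb1 : 1 - (n : ℝ) * X ≤ (1 - X) ^ n := by
      have := one_add_mul_le_pow (a := -X) (by linarith) n
      simpa [sub_eq_add_neg] using this
    have hkey : b - (1 - X) ^ n * (b - κ * X ^ p) ≤ (n + 1) * b * X := by
      have h1 : (1 - n * X) * (b - κ * X ^ p) ≤ (1 - X) ^ n * (b - κ * X ^ p) :=
        mul_le_mul_of_nonneg_right hb1 (by linarith)
      have h2 : 0 ≤ (n : ℝ) * X * (κ * X ^ p) := by positivity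
      have h3 : κ * X ^ p ≤ b * X := by gcongr
      nlinarith
    have hb0 : 0 ≤ (n + 1) * b * X := by positivity
    have hpos : 0 < volume.real (Metric.ball (0 : EuclideanSpace ℝ (Fin n)) 1) * ρ ^ n * ρ ^ p := by
      positivity
    nlinarith [mul_le_mul_of_nonneg_right hkey hpos.le, mul_nonneg hb0 hpos.le]
  · have : 0 ≤ (b - κ * X ^ p) * ρ ^ p := mul_nonneg (by linarith) hρp.le
    refine mul_nonneg (by positivity) (by linarith)
  · refine prod_mono (Metric.ball_subset_ball (by nlinarith)) (Ioo_subset_Ioo le_rfl ?_)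
    have : 0 ≤ κ * ρ ^ p * X ^ p := by positivity
    linarith
  · rw [volume_ball_prod_Ioo _ h1X]
    exact ENNReal.ofReal_ne_top

variable {a N a' ε lam κ : ℝ}

/-- The part of the upper cylinder where chains of length `m` start. -/
def chainRegion (p a' κ lam : ℝ) (z : SpaceTime n) (ρ : ℝ) (m : ℕ) : Set (SpaceTime n) :=
  {w | ‖w.1 - z.1‖ ≤ ρ * (1 - (lam⁻¹) ^ m) ∧ z.2 + (a' - 1) * ρ ^ p ≤ w.2 ∧
    w.2 ≤ z.2 + (a' + 1) * ρ ^ p - κ * ρ ^ p * ((lam⁻¹) ^ m) ^ p}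

/-- The points for which the shortest chain has length `m`. -/
def chainLayer (p a' κ lam : ℝ) (z : SpaceTime n) (ρ : ℝ) (m : ℕ) : Set (SpaceTime n) :=
  {w ∈ chainRegion p a' κ lam z ρ m | ∀ k < m, w ∉ chainRegion p a' κ lam z ρ k}

/-- A point of the open upper cylinder has positive distance to the lateral and top boundary, and
`lam⁻¹ ^ m` tends to 0, so some chain length works; the least one selects the layer. -/
lemma upperCylinder_subset_iUnion_chainLayer (h : IsChainScale p a N a' ε lam κ) (hp : 1 < p)
    (z : SpaceTime n) {ρ : ℝ} (hρ : 0 < ρ) :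
    upperCylinder p a' z ρ ⊆ ⋃ m, chainLayer p a' κ lam z ρ m := by
  classical
  intro w hw
  rw [upperCylinder, mem_parabolicCylinder hp hρ] at hw
  simp only [timeShift] at hw
  obtain ⟨hw1, hw2⟩ := hw
  rw [abs_lt] at hw2
  have hlam := h.one_lt_lam
  have hlim := tendsto_pow_atTop_nhds_zero_of_lt_one (r := lam⁻¹) (by positivity)
    (inv_lt_one_of_one_lt₀ hlam)
  have hc1 : ContinuousAt (fun ξ : ℝ => ρ * (1 - ξ)) 0 := by fun_prop
  have hc2 : ContinuousAt
      (fun ξ : ℝ => z.2 + (a' + 1) * ρ ^ p - κ * ρ ^ p * ξ ^ p) 0 :=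
    continuousAt_const.sub (continuousAt_const.mul
      (Real.continuousAt_rpow_const _ _ (Or.inr (by linarith))))
  have ht1 := hc1.tendsto.comp hlim
  have ht2 := hc2.tendsto.comp hlim
  rw [Real.zero_rpow (by linarith), mul_zero, sub_zero] at ht2
  rw [sub_zero, mul_one] at ht1
  have hex : ∃ m, w ∈ chainRegion p a' κ lam z ρ m := by
    obtain ⟨m, hm1, hm2⟩ := ((ht1.eventually (lt_mem_nhds hw1)).and
      (ht2.eventually (lt_mem_nhds (show w.2 < z.2 + (a' + 1) * ρ ^ p by linarith)))).exists
    exact ⟨m, hm1.le, by linarith, hm2.le⟩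
  exact mem_iUnion.2 ⟨Nat.find hex, Nat.find_spec hex, fun k hk => Nat.find_min hex hk⟩

/-- Neighborhoods of the layers have small measure. -/
lemma exists_layer_neighborhood (h : IsChainScale p a N a' ε lam κ) (hp : 1 < p) (ha : 0 ≤ a)
    (hN : 1 ≤ N) (ha' : 1 < a') (z : SpaceTime n) {ρ : ℝ} (hρ : 0 < ρ) (m : ℕ) :
    ∃ F : Set (SpaceTime n),
      volume F ≤ ENNReal.ofReal (4 * (n + 1) * (a' + 1) * (lam⁻¹) ^ m * cylinderVolume n p ρ) ∧
      ∀ w ∈ chainLayer p a' κ lam z ρ m,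
        parabolicCylinder p w (ε * ρ * (lam⁻¹) ^ m / 6) ⊆ F := by
  have hε := h.eps_pos
  have hε1 := h.eps_le_one ha hN
  have hlam := h.one_lt_lam
  have hlam0 : 0 < lam := by linarith
  have hlam2 : lam ≤ 2 := by linarith [h.lam_le]
  have hκ := h.kappa_pos hN
  have hκ2 := h.kappa_le
  have hεκ := h.eps_rpow_le hp hN
  have hρp : 0 < ρ ^ p := by positivity
  have hp0 : 0 < p := by linarith
  set ξ := (lam⁻¹) ^ m with hξ
  have hξ0 : 0 < ξ := by positivity
  have hξ1 : ξ ≤ 1 := pow_le_one₀ (by positivity) (inv_le_one_of_one_le₀ hlam.le)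
  have hξp : 0 < ξ ^ p := by positivity
  have hξp1 : ξ ^ p ≤ 1 := Real.rpow_le_one hξ0.le hξ1 hp0.le
  set R := ε * ρ * ξ / 6 with hR
  have hR0 : 0 < R := by positivity
  have hRρ : R ≤ ρ * ξ / 6 := by
    rw [hR]
    have : ε * ρ * ξ ≤ 1 * ρ * ξ := by gcongr
    linarith
  have hRp : R ^ p ≤ κ * ρ ^ p * ξ ^ p := by
    have h0 : 0 < ε * ρ * ξ := by positivity
    calc R ^ p ≤ (ε * ρ * ξ) ^ p := Real.rpow_le_rpow hR0.le (by rw [hR]; linarith) hp0.le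
      _ = ε ^ p * ρ ^ p * ξ ^ p := by
          rw [Real.mul_rpow (by positivity) hξ0.le, Real.mul_rpow hε.le hρ.le]
      _ ≤ _ := by gcongr
  have hV := cylinderVolume_pos (n := n) (p := p) hρ
  have hn1 : (0 : ℝ) ≤ n := Nat.cast_nonneg n
  have hU : ∀ w ∈ chainLayer p a' κ lam z ρ m, parabolicCylinder p w R ⊆
      Metric.ball z.1 ρ ×ˢ Ioo z.2 (z.2 + (a' + 1) * ρ ^ p) := by
    rintro w ⟨⟨hw1, hw2, hw3⟩, -⟩ v hv
    rw [mem_parabolicCylinder hp hR0, abs_lt] at hv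
    obtain ⟨hv1, hv2, hv3⟩ := hv
    rw [← hξ] at hw1 hw3
    have h1 : ‖v.1 - z.1‖ ≤ ‖v.1 - w.1‖ + ‖w.1 - z.1‖ := norm_sub_le_norm_sub_add_norm_sub _ _ _
    have h2 : 0 < ρ * ξ := by positivity
    have h3 : κ * ρ ^ p * ξ ^ p ≤ κ * ρ ^ p := mul_le_of_le_one_right (by positivity) hξp1
    have h4 : κ * ρ ^ p ≤ (a' - 1) / 2 * ρ ^ p := by gcongr
    have h5 : 0 < (a' - 1) / 2 * ρ ^ p := mul_pos (by linarith) hρp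
    refine ⟨?_, ?_, ?_⟩
    · rw [mem_ball_iff_norm]
      linarith
    · linarith
    · linarith
  -- Failure of the chain of length `m - 1` puts `w` within the boundary layer of parameter `lam *
  -- ξ`; doubling it to `X = 2 * lam * ξ` leaves room for the cylinder about `w`. If this is at
  -- least 1, then `4 * ξ ≥ 1` and the whole upper half of the tube is small enough.
  by_cases hX : 2 * lam * ξ < 1
  · obtain ⟨k, rfl⟩ : ∃ k, m = k + 1 := by
      refine Nat.exists_eq_succ_of_ne_zero ?_
      rintro rfl
      rw [hξ, pow_zero] at hX
      linarith
    have hk : (lam⁻¹) ^ k = lam * ξ := by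
      rw [hξ, pow_succ, mul_comm _ lam⁻¹, mul_inv_cancel_left₀ hlam0.ne']
    refine ⟨_, (volume_layer_le hp (b := a' + 1) (t := z.2) z.1 hρ hκ.le (by linarith)
      (by positivity) hX).trans (ENNReal.ofReal_le_ofReal ?_), ?_⟩
    · have h1 : 2 * lam * ξ ≤ 4 * ξ := by gcongr; linarith
      calc (n + 1) * (a' + 1) * (2 * lam * ξ) * cylinderVolume n p ρ
          ≤ (n + 1) * (a' + 1) * (4 * ξ) * cylinderVolume n p ρ := by
            gcongr
        _ = _ := by ring
    · intro w hw v hv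
      refine ⟨hU w hw hv, ?_⟩
      rintro ⟨hv4, -, hv5⟩
      rw [mem_ball_iff_norm] at hv4
      rw [mem_parabolicCylinder hp hR0, abs_lt] at hv
      obtain ⟨hv1, hv2, hv3⟩ := hv
      refine hw.2 k (by omega) ⟨?_, hw.1.2.1, ?_⟩
      · rw [hk]
        have h1 : ‖w.1 - z.1‖ ≤ ‖w.1 - v.1‖ + ‖v.1 - z.1‖ :=
          norm_sub_le_norm_sub_add_norm_sub _ _ _
        rw [norm_sub_rev w.1 v.1] at h1
        have h2 : ρ * ξ ≤ ρ * (lam * ξ) := by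
          gcongr
          nlinarith
        have h3 : 0 < ρ * ξ := by positivity
        linarith
      · rw [hk]
        rw [mul_assoc 2 lam ξ, Real.mul_rpow (by norm_num) (by positivity)] at hv5
        have h1 : (2 : ℝ) ≤ 2 ^ p := Real.self_le_rpow_of_one_le (by norm_num) hp.le
        have h2 : ξ ^ p ≤ (lam * ξ) ^ p := Real.rpow_le_rpow hξ0.le (by nlinarith) hp0.le
        have h3 : κ * ρ ^ p * ξ ^ p ≤ κ * ρ ^ p * (lam * ξ) ^ p := by gcongr
        have h4 : κ * ρ ^ p * (2 * (lam * ξ) ^ p) ≤ κ * ρ ^ p * (2 ^ p * (lam * ξ) ^ p) := by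
          gcongr
        linarith
  · refine ⟨_, ?_, hU⟩
    rw [volume_ball_prod_Ioo _ hρ]
    refine ENNReal.ofReal_le_ofReal ?_
    have h1 : 1 ≤ 4 * ξ := by nlinarith
    calc _ = (a' + 1) / 2 * cylinderVolume n p ρ := by
          rw [cylinderVolume, Real.rpow_add hρ, Real.rpow_natCast]
          ring
      _ ≤ (n + 1) * (a' + 1) * (4 * ξ) * cylinderVolume n p ρ := by
          gcongr
          have h2 : (a' + 1) * 1 ≤ (a' + 1) * (4 * ξ) := by gcongr
          have h3 : 0 ≤ n * ((a' + 1) * (4 * ξ)) := by positivity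
          linarith
      _ = _ := by ring

/-- A weak oscillation bound controls the `q`-th power of the positive part of `f - c` on upper
cylinders, where `c` is the value at a smaller cylinder with the same center. -/
lemma IsChainScale.exists_lintegral_upperCylinder_le (h : IsChainScale p a N a' ε lam κ)
    (hp : 1 < p) (ha : 0 < a) (hN : 1 ≤ N) (ha' : 1 < a') {L η q : ℝ} (hη0 : 0 < η)
    (hL : 6 * ((2 * a) ^ (1 / p) + 1) ≤ L) (hη : 4 * (L ^ ((n : ℝ) + p) + 1) * η ≤ 1)
    (hq : 0 < q) :
    ∃ C : ℝ≥0∞, C ≠ ∞ ∧ ∀ (Ω : Set (SpaceTime n)) (f : SpaceTime n → ℝ)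
      (u : SpaceTime n → ℝ → ℝ), HasWeakOsc p a N η Ω f u → AEMeasurable f (volume.restrict Ω) →
      ∀ z ρ, 0 < ρ → parabolicTube p (a' + 1) z ρ ⊆ Ω →
        ∫⁻ w in upperCylinder p a' z ρ, ENNReal.ofReal
          (f w - u (timeShift z (a * ((1 + (2 * a) ^ (1 / p)) * ε * ρ) ^ p))
            ((1 + (2 * a) ^ (1 / p)) * ε * ρ)) ^ q
        ≤ C * ENNReal.ofReal (cylinderVolume n p ρ) := by
  have hε := h.eps_pos
  have hlam := h.one_lt_lam
  have hlam0 : 0 < lam := by linarith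
  have hinv1 : lam⁻¹ < 1 := inv_lt_one_of_one_lt₀ hlam
  have hL6 : 6 ≤ L := by
    have : (0 : ℝ) ≤ (2 * a) ^ (1 / p) := by positivity
    linarith
  -- Chosen so that the chain bound `2 * m + ((a' + 1) / (a * ε ^ p) + 2)` is at most `A * (m + 1)`.
  set A := 2 + ((a' + 1) / (a * ε ^ p) + 2) with hAdef
  have hA : 0 ≤ A := by positivity
  set T := ∑' m : ℕ, ENNReal.ofReal ((1 / 2) ^ m) * ENNReal.ofReal (3 * (m + 1)) ^ q with hTdef
  have hT : T ≠ ∞ :=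
    tsum_ofReal_pow_mul_rpow_ne_top (by norm_num) (by norm_num) (by norm_num) hq.le
  set c₁ : ℝ≥0∞ := ENNReal.ofReal (6 ^ ((n : ℝ) + p) * (4 * (n + 1) * (a' + 1))) with hc₁
  set M : ℕ → ℝ≥0∞ := fun m => 2 ^ q * (T + ENNReal.ofReal (A * (m + 1)) ^ q) with hM
  refine ⟨∑' m : ℕ, c₁ * (ENNReal.ofReal ((lam⁻¹) ^ m) * M m), ?_, ?_⟩
  · rw [ENNReal.tsum_mul_left]
    refine ENNReal.mul_ne_top ENNReal.ofReal_ne_top ?_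
    have h1 := tsum_ofReal_pow_mul_rpow_ne_top (r := lam⁻¹) (by positivity) hinv1 hA hq.le
    have h2 := tsum_ofReal_pow_mul_rpow_ne_top (r := lam⁻¹) (by positivity) hinv1
      zero_le_one le_rfl
    simp only [ENNReal.rpow_zero, mul_one] at h2
    have h3 : ∑' m : ℕ, ENNReal.ofReal ((lam⁻¹) ^ m) * M m = 2 ^ q *
        ((∑' m : ℕ, ENNReal.ofReal ((lam⁻¹) ^ m)) * T + ∑' m : ℕ, ENNReal.ofReal ((lam⁻¹) ^ m) *
          ENNReal.ofReal (A * (m + 1)) ^ q) := by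
      rw [← ENNReal.tsum_mul_right, ← ENNReal.tsum_add, ← ENNReal.tsum_mul_left]
      congr 1
      ext m
      simp only [hM]
      ring
    rw [h3]
    exact ENNReal.mul_ne_top (ENNReal.rpow_ne_top_of_nonneg hq.le (by simp))
      (ENNReal.add_ne_top.2 ⟨ENNReal.mul_ne_top h2 hT, h1⟩)
  intro Ω f u hW hf z ρ hρ hΩ
  set c := u (timeShift z (a * ((1 + (2 * a) ^ (1 / p)) * ε * ρ) ^ p))
    ((1 + (2 * a) ^ (1 / p)) * ε * ρ) with hc
  have hlayer : ∀ m, ∫⁻ w in chainLayer p a' κ lam z ρ m, ENNReal.ofReal (f w - c) ^ q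
      ≤ c₁ * (ENNReal.ofReal ((lam⁻¹) ^ m) * M m) * ENNReal.ofReal (cylinderVolume n p ρ) := by
    intro m
    set r := ε * ρ * (lam⁻¹) ^ m with hr
    have hr0 : 0 < r := by positivity
    obtain ⟨F, hF, hFsub⟩ := exists_layer_neighborhood h hp ha.le hN ha' z hρ m
    -- The disjoint cylinders of radius `r / 6` lie in the small set `F`, which bounds their total
    -- volume. Their triples have radius `r / 2`, where the John-Nirenberg bound holds.
    obtain ⟨I, hIE, hI, hdis, hcov⟩ := exists_disjoint_parabolicCylinder_cover hp
      (chainLayer p a' κ lam z ρ m) (fun _ => r / 6) r (fun w _ => ⟨by positivity, by linarith⟩)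
    have hpiece : ∀ w ∈ I, ∫⁻ v in parabolicCylinder p w (r / 2), ENNReal.ofReal (f v - c) ^ q
        ≤ M m * ENNReal.ofReal (cylinderVolume n p r) := by
      intro w hw
      obtain ⟨⟨hw1, hw2, hw3⟩, -⟩ := hIE hw
      have hadm : parabolicCylinder p w (N * r) ⊆ Ω :=
        (h.parabolicCylinder_subset_tube hp ha.le hN ha' hρ (by positivity)
          (pow_le_one₀ (by positivity) hinv1.le) hw1 (by
            have : 0 < (a' - 1) * ρ ^ p := mul_pos (by linarith) (by positivity)
            linarith) hw3).trans hΩ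
      refine hW.lintegral_rpow_le hp ha.le hN hL hη0 hη hf hq hr0 hadm ?_
      have h1 := hW.chain_bound h hp ha hN ha' hη0 hL hη hρ hΩ m hw1 hw2 hw3
      have h2 : 0 ≤ (m : ℝ) * ((a' + 1) / (a * ε ^ p) + 2) := by positivity
      refine h1.trans ?_
      rw [hAdef]
      linarith
    calc ∫⁻ w in chainLayer p a' κ lam z ρ m, ENNReal.ofReal (f w - c) ^ q
        ≤ ∫⁻ w in ⋃ w ∈ I, parabolicCylinder p w (r / 2), ENNReal.ofReal (f w - c) ^ q := by
          refine lintegral_mono_set fun w hw => ?_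
          obtain ⟨v, hv, hwv⟩ := mem_iUnion₂.1 (hcov hw)
          exact mem_iUnion₂.2 ⟨v, hv, parabolicCylinder_mono v (by linarith) hwv⟩
      _ ≤ ∑' w : I, ∫⁻ v in parabolicCylinder p (w : SpaceTime n) (r / 2),
            ENNReal.ofReal (f v - c) ^ q := by
          have := hI.to_subtype
          rw [biUnion_eq_iUnion]
          exact lintegral_iUnion_le _ _
      _ ≤ ∑' w : I, M m * ENNReal.ofReal (6 ^ ((n : ℝ) + p)) *
            volume (F ∩ parabolicCylinder p (w : SpaceTime n) (r / 6)) := by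
          refine ENNReal.tsum_le_tsum fun w => (hpiece w w.2).trans_eq ?_
          have hVr : cylinderVolume n p r
              = 6 ^ ((n : ℝ) + p) * cylinderVolume n p (r / 6) := by
            rw [← cylinderVolume_mul (by norm_num) (by positivity), mul_div_cancel₀ _ (by norm_num)]
          rw [inter_eq_right.2 (hFsub w (hIE w.2)), volume_parabolicCylinder hp _ (by positivity),
            hVr, ENNReal.ofReal_mul (by positivity), ← mul_assoc]
      _ ≤ M m * ENNReal.ofReal (6 ^ ((n : ℝ) + p)) * volume F := by
          rw [ENNReal.tsum_mul_left]
          gcongr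
          exact tsum_measure_inter_le volume F hI _
            (fun w _ => measurableSet_parabolicCylinder hp w (by positivity)) hdis
      _ ≤ M m * ENNReal.ofReal (6 ^ ((n : ℝ) + p)) *
            ENNReal.ofReal (4 * (n + 1) * (a' + 1) * (lam⁻¹) ^ m * cylinderVolume n p ρ) := by
          gcongr
      _ = _ := by
          have hV := cylinderVolume_pos (n := n) (p := p) hρ
          rw [hc₁, ENNReal.ofReal_mul (p := 4 * (n + 1) * (a' + 1) * (lam⁻¹) ^ m) (by positivity),
            ENNReal.ofReal_mul (p := 4 * ((n : ℝ) + 1) * (a' + 1)) (by positivity),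
            ENNReal.ofReal_mul (p := (6 : ℝ) ^ ((n : ℝ) + p)) (by positivity)]
          ring
  calc ∫⁻ w in upperCylinder p a' z ρ, ENNReal.ofReal (f w - c) ^ q
      ≤ ∫⁻ w in ⋃ m, chainLayer p a' κ lam z ρ m, ENNReal.ofReal (f w - c) ^ q :=
        lintegral_mono_set (upperCylinder_subset_iUnion_chainLayer h hp z hρ)
    _ ≤ ∑' m, ∫⁻ w in chainLayer p a' κ lam z ρ m, ENNReal.ofReal (f w - c) ^ q :=
        lintegral_iUnion_le _ _
    _ ≤ ∑' m : ℕ, c₁ * (ENNReal.ofReal ((lam⁻¹) ^ m) * M m) *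
          ENNReal.ofReal (cylinderVolume n p ρ) := ENNReal.tsum_le_tsum hlayer
    _ = _ := ENNReal.tsum_mul_right

end Tube

/-! ### Convex hulls, recentering, time reflection, and passage between seminorms. -/

section Comparison

variable {n : ℕ} {p : ℝ}

/-- A point of the tube lies in one of the two cylinders or on the vertical segment between the
points at heights `± a * ρ ^ p` over the same spatial position. The tube is convex, being a product
of a ball and an interval. -/
lemma cylinderHull_eq_parabolicTube (hp : 1 < p) {a : ℝ} (ha : 0 < a) (z : SpaceTime n) {ρ : ℝ}
    (hρ : 0 < ρ) : cylinderHull p a z ρ = parabolicTube p (a + 1) z ρ := by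
  have hρp : 0 < ρ ^ p := by positivity
  have haρ : 0 < a * ρ ^ p := by positivity
  apply Subset.antisymm
  · refine convexHull_min ?_ ?_
    · rintro w (hw | hw) <;>
      · simp only [upperCylinder, lowerCylinder, mem_parabolicCylinder hp hρ, timeShift, abs_lt] at hw
        obtain ⟨h1, h2, h3⟩ := hw
        exact ⟨h1, abs_lt.2 ⟨by linarith, by linarith⟩⟩
    · have : parabolicTube p (a + 1) z ρ = Metric.ball z.1 ρ ×ˢ
          Ioo (z.2 - (a + 1) * ρ ^ p) (z.2 + (a + 1) * ρ ^ p) := by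
        ext w
        simp only [parabolicTube, mem_ofPred_eq, mem_prod, mem_ball_iff_norm, mem_Ioo, abs_lt]
        constructor <;> rintro ⟨h1, h2, h3⟩ <;> exact ⟨h1, by linarith, by linarith⟩
      rw [this]
      exact (convex_ball _ _).prod (convex_Ioo _ _)
  · rintro w ⟨hw1, hw2⟩
    rw [abs_lt] at hw2
    set v := w.2 - z.2 with hv
    by_cases h1 : a * ρ ^ p < v
    · refine subset_convexHull ℝ _ (Or.inl ?_)
      rw [upperCylinder, mem_parabolicCylinder hp hρ, abs_lt]
      simp only [timeShift]
      exact ⟨hw1, by linarith, by linarith⟩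
    by_cases h2 : v < -(a * ρ ^ p)
    · refine subset_convexHull ℝ _ (Or.inr ?_)
      rw [lowerCylinder, mem_parabolicCylinder hp hρ, abs_lt]
      simp only [timeShift]
      exact ⟨hw1, by linarith, by linarith⟩
    push Not at h1 h2
    have hup : ((w.1, z.2 + a * ρ ^ p) : SpaceTime n) ∈ cylinderHull p a z ρ := by
      refine subset_convexHull ℝ _ (Or.inl ?_)
      rw [upperCylinder, mem_parabolicCylinder hp hρ]
      simpa [timeShift, hρp] using hw1
    have hlo : ((w.1, z.2 + -(a * ρ ^ p)) : SpaceTime n) ∈ cylinderHull p a z ρ := by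
      refine subset_convexHull ℝ _ (Or.inr ?_)
      rw [lowerCylinder, mem_parabolicCylinder hp hρ]
      simpa [timeShift, hρp] using hw1
    have hα : 0 ≤ (1 + v / (a * ρ ^ p)) / 2 := by
      have : -1 ≤ v / (a * ρ ^ p) := by rw [le_div_iff₀ haρ]; linarith
      linarith
    have hβ : 0 ≤ (1 - v / (a * ρ ^ p)) / 2 := by
      have : v / (a * ρ ^ p) ≤ 1 := by rw [div_le_iff₀ haρ]; linarith
      linarith
    convert! convex_convexHull ℝ _ hup hlo hα hβ (by ring) using 1
    refine Prod.ext ?_ ?_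
    · simp only [Prod.smul_mk, Prod.mk_add_mk]
      module
    · simp only [Prod.smul_mk, Prod.mk_add_mk, smul_eq_mul]
      have : v / (a * ρ ^ p) * (a * ρ ^ p) = v := div_mul_cancel₀ _ haρ.ne'
      linear_combination -this + hv

/-- The weak oscillation condition, in terms of the centers of the cylinders. -/
def HasCenteredWeakOsc (p a θ η : ℝ) (Ω : Set (SpaceTime n)) (f : SpaceTime n → ℝ)
    (c : SpaceTime n → ℝ → ℝ) : Prop :=
  ∀ z r, 0 < r → parabolicTube p (a + 1) z (θ * r) ⊆ Ω →
    volume {w ∈ upperCylinder p a z r | c z r + 1 < f w}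
      ≤ ENNReal.ofReal (η * cylinderVolume n p r) ∧
    volume {w ∈ lowerCylinder p a z r | f w < c z r - 1}
      ≤ ENNReal.ofReal (η * cylinderVolume n p r)

lemma timeShift_timeShift (z : SpaceTime n) (s t : ℝ) :
    timeShift (timeShift z s) t = timeShift z (s + t) := by
  simp only [timeShift, add_assoc]

lemma timeShift_zero (z : SpaceTime n) : timeShift z 0 = z := by
  simp [timeShift]

/-- Moving the center down by `a * r ^ p` turns the upper cylinder into `B(z, r)`. The factor `N` is
large enough for `B(z, N * r)` to contain the moved tube of radius `θ * r`, whose lowest time is `(a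
+ (a + 1) * θ ^ p) * r ^ p` below `z`. -/
lemma HasCenteredWeakOsc.hasWeakOsc (hp : 1 < p) {a θ η : ℝ} (ha : 0 ≤ a) (hθ : 0 < θ)
    {Ω : Set (SpaceTime n)} {f : SpaceTime n → ℝ} {c : SpaceTime n → ℝ → ℝ}
    (h : HasCenteredWeakOsc p a θ η Ω f c) :
    HasWeakOsc p a ((a + (a + 1) * θ ^ p) ^ (1 / p) + θ) η Ω f
      (fun z r => c (timeShift z (-(a * r ^ p))) r) := by
  intro z r hr hz
  have hp0 : 0 < p := by linarith
  set b := (a + (a + 1) * θ ^ p) ^ (1 / p) with hb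
  have hb0 : 0 ≤ b := by positivity
  have hbp : b ^ p = a + (a + 1) * θ ^ p := by
    rw [hb, ← Real.rpow_mul (by positivity), one_div, inv_mul_cancel₀ hp0.ne', Real.rpow_one]
  have key := h (timeShift z (-(a * r ^ p))) r hr ?_
  · rw [upperCylinder, lowerCylinder, timeShift_timeShift, timeShift_timeShift, neg_add_cancel,
      timeShift_zero, show -(a * r ^ p) + -(a * r ^ p) = -(2 * a * r ^ p) by ring] at key
    exact key
  · refine Subset.trans ?_ hz
    rintro w ⟨hw1, hw2⟩
    simp only [timeShift] at hw1 hw2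
    have hbr : b ^ p * r ^ p ≤ ((b + θ) * r) ^ p := by
      rw [← Real.mul_rpow hb0 hr.le]
      gcongr
      linarith
    rw [hbp] at hbr
    rw [Real.mul_rpow hθ.le hr.le, abs_lt] at hw2
    rw [mem_parabolicCylinder hp (by positivity), abs_lt]
    have : 0 ≤ a * r ^ p := by positivity
    have : 0 ≤ b * r := by positivity
    refine ⟨?_, ?_, ?_⟩ <;> linarith [hw2.1, hw2.2]

/-- Reflection in time, `(x, t) ↦ (x, -t)`. -/
def timeReflection (n : ℕ) : SpaceTime n ≃ᵐ SpaceTime n :=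
  (MeasurableEquiv.refl _).prodCongr (MeasurableEquiv.neg ℝ)

lemma timeReflection_apply (w : SpaceTime n) : timeReflection n w = (w.1, -w.2) := rfl

lemma timeReflection_timeReflection (w : SpaceTime n) :
    timeReflection n (timeReflection n w) = w := by
  simp [timeReflection_apply]

lemma measurePreserving_timeReflection (n : ℕ) :
    MeasurePreserving (timeReflection n) volume volume :=
  (MeasurePreserving.id volume).prod (Measure.measurePreserving_neg volume)

lemma timeReflection_mem_parabolicCylinder (hp : 1 < p) {z w : SpaceTime n} {r : ℝ} (hr : 0 < r) :
    timeReflection n w ∈ parabolicCylinder p (timeReflection n z) r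
      ↔ w ∈ parabolicCylinder p z r := by
  rw [mem_parabolicCylinder hp hr, mem_parabolicCylinder hp hr]
  simp only [timeReflection_apply]
  rw [show -w.2 - -z.2 = -(w.2 - z.2) by ring, abs_neg]

lemma timeReflection_timeShift (z : SpaceTime n) (s : ℝ) :
    timeReflection n (timeShift z s) = timeShift (timeReflection n z) (-s) := by
  simp [timeReflection_apply, timeShift, add_comm]

lemma preimage_timeReflection_lowerCylinder (hp : 1 < p) (a : ℝ) (z : SpaceTime n) {r : ℝ}
    (hr : 0 < r) :
    timeReflection n ⁻¹' lowerCylinder p a (timeReflection n z) r = upperCylinder p a z r := by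
  ext w
  rw [mem_preimage, lowerCylinder, upperCylinder, ← timeReflection_timeShift,
    timeReflection_mem_parabolicCylinder hp hr]

lemma preimage_timeReflection_upperCylinder (hp : 1 < p) (a : ℝ) (z : SpaceTime n) {r : ℝ}
    (hr : 0 < r) :
    timeReflection n ⁻¹' upperCylinder p a (timeReflection n z) r = lowerCylinder p a z r := by
  ext w
  rw [mem_preimage, lowerCylinder, upperCylinder, ← neg_neg (a * r ^ p),
    ← timeReflection_timeShift, timeReflection_mem_parabolicCylinder hp hr, neg_neg]

lemma preimage_timeReflection_parabolicTube (b : ℝ) (z : SpaceTime n) (r : ℝ) :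
    timeReflection n ⁻¹' parabolicTube p b z r = parabolicTube p b (timeReflection n z) r := by
  ext w
  simp only [mem_preimage, parabolicTube, mem_ofPred_eq, timeReflection_apply]
  rw [show -w.2 - z.2 = -(w.2 - -z.2) by ring, abs_neg]

/-- Reflecting time exchanges upper and lower cylinders, and the sign change of `f` exchanges the
two inequalities back. Only the upper estimate then needs a proof. -/
lemma HasCenteredWeakOsc.reflect (hp : 1 < p) {a θ η : ℝ} {Ω : Set (SpaceTime n)}
    {f : SpaceTime n → ℝ} {c : SpaceTime n → ℝ → ℝ} (h : HasCenteredWeakOsc p a θ η Ω f c) :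
    HasCenteredWeakOsc p a θ η (timeReflection n ⁻¹' Ω) (fun w => -f (timeReflection n w))
      (fun z r => -c (timeReflection n z) r) := by
  intro z r hr hz
  have hz' : parabolicTube p (a + 1) (timeReflection n z) (θ * r) ⊆ Ω := by
    rw [← preimage_timeReflection_parabolicTube]
    intro w hw
    have := hz hw
    rwa [mem_preimage, timeReflection_timeReflection] at this
  obtain ⟨h1, h2⟩ := h (timeReflection n z) r hr hz'
  rw [← (measurePreserving_timeReflection n).measure_preimage_equiv] at h1 h2
  constructor
  · refine (measure_mono ?_).trans h2
    rintro w ⟨hw1, hw2⟩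
    rw [← preimage_timeReflection_lowerCylinder hp a z hr] at hw1
    exact ⟨hw1, by linarith⟩
  · refine (measure_mono ?_).trans h1
    rintro w ⟨hw1, hw2⟩
    rw [← preimage_timeReflection_upperCylinder hp a z hr] at hw1
    exact ⟨hw1, by linarith⟩

/-- A weak oscillation bound implies bounds for the `q`-th powers over all upper and lower
cylinders of a tube in `Ω`. -/
lemma exists_lintegral_le_of_hasCenteredWeakOsc (n : ℕ) (hp : 1 < p) {a a' θ q : ℝ} (ha : 0 < a)
    (ha' : 1 < a') (hθ : 1 ≤ θ) (hq : 0 < q) :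
    ∃ η : ℝ, 0 < η ∧ ∃ C : ℝ≥0∞, C ≠ ∞ ∧
      ∀ (Ω : Set (SpaceTime n)) (f : SpaceTime n → ℝ) (c : SpaceTime n → ℝ → ℝ),
      HasCenteredWeakOsc p a θ η Ω f c → AEMeasurable f (volume.restrict Ω) →
      ∀ z ρ, 0 < ρ → parabolicTube p (a' + 1) z ρ ⊆ Ω → ∃ c₀ : ℝ,
        ∫⁻ w in upperCylinder p a' z ρ, ENNReal.ofReal (f w - c₀) ^ q
          ≤ C * ENNReal.ofReal (cylinderVolume n p ρ) ∧
        ∫⁻ w in lowerCylinder p a' z ρ, ENNReal.ofReal (c₀ - f w) ^ q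
          ≤ C * ENNReal.ofReal (cylinderVolume n p ρ) := by
  set N := (a + (a + 1) * θ ^ p) ^ (1 / p) + θ with hN
  have hN1 : 1 ≤ N := by
    have : 0 ≤ (a + (a + 1) * θ ^ p) ^ (1 / p) := by positivity
    linarith
  set K := (2 * a) ^ (1 / p) with hK
  have hK0 : 0 ≤ K := by positivity
  set L := 6 * (K + 1) with hL
  have hL0 : 0 ≤ L := by positivity
  set η := 1 / (4 * (L ^ ((n : ℝ) + p) + 1)) with hη
  have hη0 : 0 < η := by positivity
  have hη1 : 4 * (L ^ ((n : ℝ) + p) + 1) * η ≤ 1 := by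
    rw [hη, mul_one_div_cancel (by positivity)]
  obtain ⟨ε, lam, κ, hs⟩ := exists_isChainScale hp ha hN1 ha'
  obtain ⟨C, hC, hbound⟩ := hs.exists_lintegral_upperCylinder_le hp ha hN1 ha' hη0 hL.ge hη1 hq
  refine ⟨η, hη0, C, hC, ?_⟩
  have main : ∀ (Ω : Set (SpaceTime n)) (f : SpaceTime n → ℝ) (c : SpaceTime n → ℝ → ℝ),
      HasCenteredWeakOsc p a θ η Ω f c → AEMeasurable f (volume.restrict Ω) →
      ∀ z ρ, 0 < ρ → parabolicTube p (a' + 1) z ρ ⊆ Ω →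
        ∫⁻ w in upperCylinder p a' z ρ, ENNReal.ofReal (f w - c z ((1 + K) * ε * ρ)) ^ q
          ≤ C * ENNReal.ofReal (cylinderVolume n p ρ) := by
    intro Ω f c h hf z ρ hρ hz
    have := hbound Ω f _ (h.hasWeakOsc hp ha.le (by linarith)) hf z ρ hρ hz
    rwa [timeShift_timeShift, add_neg_cancel, timeShift_zero] at this
  intro Ω f c h hf z ρ hρ hz
  -- The chain ends at the upper cylinder of `B(z, R)`, so in centered form its value is `c z R`.
  -- The reflected chain ends at the negative of the same number, which yields one constant for both
  -- halves.
  refine ⟨c z ((1 + K) * ε * ρ), main Ω f c h hf z ρ hρ hz, ?_⟩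
  have hmp := measurePreserving_timeReflection n
  have hf' : AEMeasurable (fun w => -f (timeReflection n w))
      (volume.restrict (timeReflection n ⁻¹' Ω)) :=
    (hf.comp_quasiMeasurePreserving
      (hmp.restrict_preimage_emb (timeReflection n).measurableEmbedding
        Ω).quasiMeasurePreserving).neg
  have h1 := main _ _ _ (h.reflect hp) hf' (timeReflection n z) ρ hρ (by
    rw [← preimage_timeReflection_parabolicTube]
    exact preimage_mono hz)
  rw [timeReflection_timeReflection] at h1
  rw [← timeReflection_timeReflection z, ← hmp.setLIntegral_comp_preimage_emb
    (timeReflection n).measurableEmbedding, preimage_timeReflection_lowerCylinder hp _ _ hρ,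
    timeReflection_timeReflection]
  refine le_trans (lintegral_mono fun w => ?_) h1
  refine ENNReal.rpow_le_rpow (ENNReal.ofReal_le_ofReal ?_) hq.le
  linarith

lemma ofReal_posPart (x : ℝ) : ENNReal.ofReal x⁺ = ENNReal.ofReal x := by
  rcases le_total x 0 with h | h
  · rw [posPart_eq_zero.2 h, ENNReal.ofReal_zero, ENNReal.ofReal_of_nonpos h]
  · rw [posPart_eq_self.2 h]

lemma ofReal_negPart (x : ℝ) : ENNReal.ofReal x⁻ = ENNReal.ofReal (-x) := by
  rw [← posPart_neg, ofReal_posPart]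

lemma parabolicOsc_eq (p a q : ℝ) (f : SpaceTime n → ℝ) (z : SpaceTime n) (ρ : ℝ) :
    parabolicOsc p a q f z ρ = ⨅ c : ℝ,
      ((⨍⁻ w in upperCylinder p a z ρ, ENNReal.ofReal (f w - c) ^ q ∂volume)
      + (⨍⁻ w in lowerCylinder p a z ρ, ENNReal.ofReal (c - f w) ^ q ∂volume)) ^ (1 / q) := by
  simp only [parabolicOsc, ofReal_posPart, ofReal_negPart, neg_sub]

/-- Chebyshev's inequality for the `q`-th power, with the level `H` tuned so that `(h / H) ^ q = η`.
-/
lemma measure_superlevel_le_of_setLAverage {α : Type*} [MeasurableSpace α] {μ : Measure α}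
    {B : Set α} (hB0 : μ B ≠ 0) (hB : μ B ≠ ∞) {g : α → ℝ} (hg : AEMeasurable g (μ.restrict B))
    {q H h η : ℝ} (hq : 0 < q) (hH : 0 < H) (hη : 0 ≤ η) (hh : 0 ≤ h) (hHh : h ^ q = η * H ^ q)
    (hav : ⨍⁻ w in B, ENNReal.ofReal (g w) ^ q ∂μ ≤ ENNReal.ofReal h ^ q) :
    μ {w ∈ B | H < g w} ≤ ENNReal.ofReal η * μ B := by
  rw [setLAverage_eq, ENNReal.div_le_iff hB0 hB] at hav
  have h1 := (mul_meas_ge_le_lintegral₀ (hg.ennreal_ofReal.pow_const q)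
    (ENNReal.ofReal H ^ q)).trans hav
  have h2 : μ {w ∈ B | H < g w} ≤ μ.restrict B {w | ENNReal.ofReal H ^ q
      ≤ ENNReal.ofReal (g w) ^ q} := by
    refine le_trans (measure_mono ?_) (Measure.le_restrict_apply _ _)
    exact fun w hw => ⟨ENNReal.rpow_le_rpow (ENNReal.ofReal_le_ofReal hw.2.le) hq.le, hw.1⟩
  have h3 : ENNReal.ofReal H ^ q ≠ 0 := by
    rw [ENNReal.ofReal_rpow_of_pos hH]
    exact (ENNReal.ofReal_pos.2 (by positivity)).ne'
  have h4 : ENNReal.ofReal H ^ q ≠ ∞ := ENNReal.rpow_ne_top_of_nonneg hq.le ENNReal.ofReal_ne_top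
  refine h2.trans ((ENNReal.mul_le_mul_iff_right h3 h4).1 (h1.trans_eq ?_))
  rw [ENNReal.ofReal_rpow_of_nonneg hh hq.le, hHh, ENNReal.ofReal_mul hη,
    ENNReal.ofReal_rpow_of_pos hH]
  ring

/-- The seminorms with different parameters are comparable. -/
lemma exists_pbmoSeminorm_le (n : ℕ) (hp : 1 < p) {a q θ a' q' θ' : ℝ} (ha : 1 < a) (hq : 0 < q)
    (hθ : 1 ≤ θ) (ha' : 1 < a') (hq' : 0 < q') (hθ' : 1 ≤ θ') :
    ∃ C : ℝ≥0, 0 < C ∧ ∀ (Ω : Set (SpaceTime n)) (f : SpaceTime n → ℝ),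
      AEMeasurable f (volume.restrict Ω) →
      pbmoSeminorm p a' q' θ' Ω f ≤ C * pbmoSeminorm p a q θ Ω f := by
  have hp0 : 0 < p := by linarith
  obtain ⟨η, hη, C, hC, hbound⟩ := exists_lintegral_le_of_hasCenteredWeakOsc n hp
    (by linarith : 0 < a) ha' hθ hq'
  set Λ := η⁻¹ ^ (1 / q) with hΛ
  have hΛ0 : 0 < Λ := by positivity
  have hΛq : η * Λ ^ q = 1 := by
    rw [hΛ, ← Real.rpow_mul (by positivity), one_div, inv_mul_cancel₀ hq.ne', Real.rpow_one,
      mul_inv_cancel₀ hη.ne']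
  set D : ℝ≥0∞ := ENNReal.ofReal Λ * (C + C) ^ (1 / q') with hD
  have hDtop : D ≠ ∞ := ENNReal.mul_ne_top ENNReal.ofReal_ne_top
    (ENNReal.rpow_ne_top_of_nonneg (by positivity) (ENNReal.add_ne_top.2 ⟨hC, hC⟩))
  refine ⟨D.toNNReal + 1, by positivity, ?_⟩
  intro Ω f hf
  have hDle : D ≤ ((D.toNNReal + 1 : ℝ≥0) : ℝ≥0∞) := by
    rw [ENNReal.coe_add, ENNReal.coe_toNNReal hDtop]
    exact le_self_add
  set E : ℝ≥0∞ := ((D.toNNReal + 1 : ℝ≥0) : ℝ≥0∞) with hE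
  have hE0 : E ≠ 0 := by
    rw [hE, ENNReal.coe_ne_zero]
    positivity
  rw [← ENNReal.div_le_iff' hE0 ENNReal.coe_ne_top]
  -- Working with any `x` strictly above the seminorm lets near-optimal constants `c` be chosen in
  -- the infimum, and gives a positive scale even if the seminorm vanishes.
  refine le_of_forall_gt_imp_ge_of_dense fun x hx => ?_
  rcases eq_or_ne x ∞ with rfl | hxtop
  · exact le_top
  rw [ENNReal.div_le_iff' hE0 ENNReal.coe_ne_top]
  obtain ⟨h, hh0, rfl⟩ : ∃ h : ℝ, 0 < h ∧ x = ENNReal.ofReal h :=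
    ⟨x.toReal, ENNReal.toReal_pos (bot_le.trans_lt hx).ne' hxtop, (ENNReal.ofReal_toReal hxtop).symm⟩
  have hc : ∀ z r, 0 < r → parabolicTube p (a + 1) z (θ * r) ⊆ Ω → ∃ c : ℝ,
      ⨍⁻ w in upperCylinder p a z r, ENNReal.ofReal (f w - c) ^ q ∂volume ≤ ENNReal.ofReal h ^ q ∧
      ⨍⁻ w in lowerCylinder p a z r, ENNReal.ofReal (c - f w) ^ q ∂volume
        ≤ ENNReal.ofReal h ^ q := by
    intro z r hr hz
    have h1 : parabolicOsc p a q f z r < ENNReal.ofReal h := by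
      refine lt_of_le_of_lt ?_ hx
      refine le_iSup_of_le z (le_iSup_of_le r (le_iSup_of_le hr (le_iSup_of_le ?_ le_rfl)))
      rwa [cylinderHull_eq_parabolicTube hp (by linarith) z (by positivity)]
    rw [parabolicOsc_eq, iInf_lt_iff] at h1
    obtain ⟨c, hc⟩ := h1
    rw [one_div, ENNReal.rpow_inv_lt_iff hq] at hc
    exact ⟨c, le_self_add.trans hc.le, le_add_self.trans hc.le⟩
  choose! c hc1 hc2 using hc
  set H := Λ * h with hH
  have hH0 : 0 < H := by positivity
  have hHh : h ^ q = η * H ^ q := by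
    rw [hH, Real.mul_rpow hΛ0.le hh0.le, ← mul_assoc, hΛq, one_mul]
  have hsubΩ : ∀ z r, 0 < r → parabolicTube p (a + 1) z (θ * r) ⊆ Ω →
      upperCylinder p a z r ∪ lowerCylinder p a z r ⊆ Ω := by
    intro z r hr hz
    refine Subset.trans (subset_convexHull ℝ _) (Subset.trans ?_ hz)
    have h1 := cylinderHull_eq_parabolicTube hp (by linarith : 0 < a) z hr
    rw [cylinderHull] at h1
    rw [h1]
    rintro w ⟨hw1, hw2⟩
    have h2 : r ≤ θ * r := by nlinarith
    exact ⟨hw1.trans_le h2, hw2.trans_le (by gcongr)⟩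
  -- Dividing by `H = Λ * h` normalizes the level in the weak condition to 1; `Λ` depends only on
  -- `η` and `q`, so undoing the scaling costs a fixed factor.
  have hweak : HasCenteredWeakOsc p a θ η Ω (fun w => f w / H) (fun z r => c z r / H) := by
    intro z r hr hz
    have hsub := union_subset_iff.1 (hsubΩ z r hr hz)
    have hv := cylinderVolume_pos (n := n) (p := p) hr
    constructor
    · have hvol := volume_parabolicCylinder hp (timeShift z (a * r ^ p)) hr
      have h1 := measure_superlevel_le_of_setLAverage (B := upperCylinder p a z r)
        (g := fun w => f w - c z r) (μ := volume)
        (by rw [upperCylinder, hvol]; exact (ENNReal.ofReal_pos.2 hv).ne')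
        (by rw [upperCylinder, hvol]; exact ENNReal.ofReal_ne_top)
        ((hf.mono_measure (Measure.restrict_mono_set _ hsub.1)).sub_const _) hq hH0 hη.le hh0.le
        hHh (hc1 z r hr hz)
      rw [ENNReal.ofReal_mul hη.le, ← hvol]
      refine le_trans (measure_mono ?_) h1
      rintro w ⟨hw1, hw2⟩
      refine ⟨hw1, ?_⟩
      rw [div_add_one hH0.ne', div_lt_div_iff_of_pos_right hH0] at hw2
      linarith
    · have hvol := volume_parabolicCylinder hp (timeShift z (-(a * r ^ p))) hr
      have h1 := measure_superlevel_le_of_setLAverage (B := lowerCylinder p a z r)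
        (g := fun w => c z r - f w) (μ := volume)
        (by rw [lowerCylinder, hvol]; exact (ENNReal.ofReal_pos.2 hv).ne')
        (by rw [lowerCylinder, hvol]; exact ENNReal.ofReal_ne_top)
        ((hf.mono_measure (Measure.restrict_mono_set _ hsub.2)).const_sub _) hq hH0 hη.le hh0.le
        hHh (hc2 z r hr hz)
      rw [ENNReal.ofReal_mul hη.le, ← hvol]
      refine le_trans (measure_mono ?_) h1
      rintro w ⟨hw1, hw2⟩
      refine ⟨hw1, ?_⟩
      rw [div_sub_one hH0.ne', div_lt_div_iff_of_pos_right hH0] at hw2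
      linarith
  refine iSup_le fun z => iSup_le fun ρ => iSup_le fun hρ => iSup_le fun hz => ?_
  have hz' : parabolicTube p (a' + 1) z ρ ⊆ Ω := by
    rw [cylinderHull_eq_parabolicTube hp (by linarith) z (by positivity)] at hz
    refine Subset.trans ?_ hz
    rintro w ⟨hw1, hw2⟩
    have h2 : ρ ≤ θ' * ρ := by nlinarith
    exact ⟨hw1.trans_le h2, hw2.trans_le (by gcongr)⟩
  obtain ⟨c₀, hup, hlo⟩ := hbound Ω _ _ hweak (hf.div_const H) z ρ hρ hz'
  have hv := cylinderVolume_pos (n := n) (p := p) hρ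
  have hscale : ∀ (B : Set (SpaceTime n)) (g : SpaceTime n → ℝ),
      volume B = ENNReal.ofReal (cylinderVolume n p ρ) →
      ∫⁻ w in B, ENNReal.ofReal (g w / H) ^ q' ≤ C * ENNReal.ofReal (cylinderVolume n p ρ) →
      ⨍⁻ w in B, ENNReal.ofReal (g w) ^ q' ∂volume ≤ ENNReal.ofReal H ^ q' * C := by
    intro B g hB hg
    have h0 : ENNReal.ofReal H ^ q' ≠ ∞ :=
      ENNReal.rpow_ne_top_of_nonneg hq'.le ENNReal.ofReal_ne_top
    rw [setLAverage_eq, hB, ENNReal.div_le_iff (ENNReal.ofReal_pos.2 hv).ne' ENNReal.ofReal_ne_top,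
      mul_assoc]
    refine le_trans (le_of_eq ?_) (mul_le_mul_right hg _)
    rw [← lintegral_const_mul' _ _ h0]
    refine lintegral_congr fun w => ?_
    rw [← ENNReal.mul_rpow_of_nonneg _ _ hq'.le, ← ENNReal.ofReal_mul hH0.le,
      mul_div_cancel₀ _ hH0.ne']
  rw [parabolicOsc_eq]
  refine iInf_le_of_le (H * c₀) ?_
  have h1 := hscale (upperCylinder p a' z ρ) (fun w => f w - H * c₀)
    (volume_parabolicCylinder hp _ hρ) (by
      refine le_trans (le_of_eq (lintegral_congr fun w => ?_)) hup
      rw [sub_div, mul_div_cancel_left₀ _ hH0.ne'])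
  have h2 := hscale (lowerCylinder p a' z ρ) (fun w => H * c₀ - f w)
    (volume_parabolicCylinder hp _ hρ) (by
      refine le_trans (le_of_eq (lintegral_congr fun w => ?_)) hlo
      rw [sub_div, mul_div_cancel_left₀ _ hH0.ne'])
  calc _ ≤ (ENNReal.ofReal H ^ q' * C + ENNReal.ofReal H ^ q' * C) ^ (1 / q') :=
        ENNReal.rpow_le_rpow (add_le_add h1 h2) (by positivity)
    _ = D * ENNReal.ofReal h := by
        rw [← mul_add, ENNReal.mul_rpow_of_nonneg _ _ (by positivity), ← ENNReal.rpow_mul,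
          mul_one_div_cancel hq'.ne', ENNReal.rpow_one, hH, ENNReal.ofReal_mul hΛ0.le, hD]
        ring
    _ ≤ _ := by gcongr

/-- Functions of finite reference seminorm are locally integrable. -/
lemma locallyIntegrableOn_of_pbmoRefSeminorm_lt_top (hp : 1 < p) {Ω : Set (SpaceTime n)}
    (hΩ : IsOpen Ω) {f : SpaceTime n → ℝ} (hf : AEMeasurable f (volume.restrict Ω))
    (h : pbmoRefSeminorm p Ω f < ∞) : LocallyIntegrableOn f Ω := by
  intro x hx
  obtain ⟨r₀, hr₀, hsub⟩ := exists_parabolicCylinder_subset hp hΩ hx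
  -- A tube of half-height `4 * ρ ^ p` centered `3 * ρ ^ p` away from `x` in time reaches `7 * ρ ^
  -- p` at most.
  set ρ := r₀ / 7 with hρdef
  have hρ : 0 < ρ := by positivity
  have hρ7 : 7 * ρ ^ p ≤ r₀ ^ p := by
    have h1 : r₀ = 7 * ρ := by rw [hρdef]; ring
    have h2 : (7 : ℝ) ≤ 7 ^ p := Real.self_le_rpow_of_one_le (by norm_num) hp.le
    rw [h1, Real.mul_rpow (by norm_num) hρ.le]
    gcongr
  have hv := cylinderVolume_pos (n := n) (p := p) hρ
  have hρp : 0 < ρ ^ p := by positivity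
  have hosc : ∀ z : SpaceTime n, z.1 = x.1 → |z.2 - x.2| = 3 * ρ ^ p → ∃ c : ℝ,
      ⨍⁻ w in upperCylinder p 3 z ρ, ENNReal.ofReal (f w - c) ∂volume < ∞ ∧
      ⨍⁻ w in lowerCylinder p 3 z ρ, ENNReal.ofReal (c - f w) ∂volume < ∞ := by
    intro z hz1 hz2
    have h1 : parabolicOsc p 3 1 f z ρ < ∞ := by
      refine lt_of_le_of_lt ?_ h
      refine le_iSup_of_le z (le_iSup_of_le ρ (le_iSup_of_le hρ (le_iSup_of_le ?_ le_rfl)))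
      rw [one_mul, cylinderHull_eq_parabolicTube hp (by norm_num) z hρ]
      refine Subset.trans ?_ hsub
      rintro w ⟨hw1, hw2⟩
      rw [mem_parabolicCylinder hp hr₀, ← hz1]
      refine ⟨by linarith, ?_⟩
      have := abs_sub_le w.2 z.2 x.2
      linarith
    rw [parabolicOsc_eq, iInf_lt_iff] at h1
    obtain ⟨c, hc⟩ := h1
    simp only [div_one, ENNReal.rpow_one] at hc
    exact ⟨c, (ENNReal.add_lt_top.1 hc).1, (ENNReal.add_lt_top.1 hc).2⟩
  have hfin : ∀ g : SpaceTime n → ℝ≥0∞, ⨍⁻ w in parabolicCylinder p x ρ, g w ∂volume < ∞ →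
      ∫⁻ w in parabolicCylinder p x ρ, g w < ∞ := by
    intro g hg
    rw [setLAverage_eq, volume_parabolicCylinder hp x hρ] at hg
    by_contra hlt
    rw [not_lt_top_iff.1 hlt, ENNReal.top_div_of_ne_top ENNReal.ofReal_ne_top] at hg
    exact lt_irrefl _ hg
  -- `B(x, ρ)` is the upper cylinder for the center shifted down and the lower one for the center
  -- shifted up. The first controls the positive part of `f` there, the second the negative part.
  obtain ⟨c₁, hc₁, -⟩ := hosc (timeShift x (-(3 * ρ ^ p))) rfl (by
    simp only [timeShift, add_sub_cancel_left, abs_neg]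
    exact abs_of_pos (by positivity))
  obtain ⟨c₂, -, hc₂⟩ := hosc (timeShift x (3 * ρ ^ p)) rfl (by
    simp only [timeShift, add_sub_cancel_left]
    exact abs_of_pos (by positivity))
  rw [upperCylinder, timeShift_timeShift, neg_add_cancel, timeShift_zero] at hc₁
  rw [lowerCylinder, timeShift_timeShift, add_neg_cancel, timeShift_zero] at hc₂
  have hρΩ : parabolicCylinder p x ρ ⊆ Ω :=
    (parabolicCylinder_mono x (by rw [hρdef]; linarith)).trans hsub
  have hfB := hf.mono_measure (Measure.restrict_mono_set volume hρΩ)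
  refine ⟨parabolicCylinder p x ρ, mem_nhdsWithin_of_mem_nhds
    ((isOpen_parabolicCylinder hp x hρ).mem_nhds (self_mem_parabolicCylinder hp x hρ)),
    hfB.aestronglyMeasurable, ?_⟩
  rw [hasFiniteIntegral_iff_norm]
  calc ∫⁻ w in parabolicCylinder p x ρ, ENNReal.ofReal ‖f w‖
      ≤ ∫⁻ w in parabolicCylinder p x ρ, (ENNReal.ofReal (f w - c₁) + ENNReal.ofReal (c₂ - f w)
          + ENNReal.ofReal (|c₁| + |c₂|)) := by
        refine lintegral_mono fun w => ?_
        rw [← ofReal_posPart (f w - c₁), ← ofReal_posPart (c₂ - f w),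
          ← ENNReal.ofReal_add (posPart_nonneg _) (posPart_nonneg _),
          ← ENNReal.ofReal_add (by positivity) (by positivity)]
        refine ENNReal.ofReal_le_ofReal ?_
        have h1 := le_posPart (f w - c₁)
        have h2 := le_posPart (c₂ - f w)
        have h3 := posPart_nonneg (f w - c₁)
        have h4 := posPart_nonneg (c₂ - f w)
        rw [Real.norm_eq_abs, abs_le]
        constructor <;> linarith [neg_abs_le c₁, neg_abs_le c₂, le_abs_self c₁, le_abs_self c₂,
          abs_nonneg c₁, abs_nonneg c₂]
    _ = (∫⁻ w in parabolicCylinder p x ρ, ENNReal.ofReal (f w - c₁))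
          + (∫⁻ w in parabolicCylinder p x ρ, ENNReal.ofReal (c₂ - f w))
          + ENNReal.ofReal (|c₁| + |c₂|) * volume (parabolicCylinder p x ρ) := by
        rw [lintegral_add_right _ measurable_const, lintegral_add_left'
          (hfB.sub_const c₁).ennreal_ofReal, lintegral_const, Measure.restrict_apply_univ]
    _ < ∞ := by
        rw [volume_parabolicCylinder hp x hρ]
        exact ENNReal.add_lt_top.2 ⟨ENNReal.add_lt_top.2 ⟨hfin _ hc₁, hfin _ hc₂⟩,
          ENNReal.mul_lt_top ENNReal.ofReal_lt_top ENNReal.ofReal_lt_top⟩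

/-- An open set is a countable union of closed sets, hence of their compact intersections with
closed balls, and measurability passes to countable unions. -/
lemma MemLpLocOn.aemeasurable {δ : ℝ} {Ω : Set (SpaceTime n)} (hΩ : IsOpen Ω)
    {f : SpaceTime n → ℝ} (hf : MemLpLocOn δ Ω f) : AEMeasurable f (volume.restrict Ω) := by
  obtain ⟨F, hF, hFΩ, hFU, -⟩ := hΩ.exists_iUnion_isClosed
  have hcover : Ω = ⋃ k : ℕ, ⋃ j : ℕ, F k ∩ Metric.closedBall 0 j := by
    rw [← hFU]
    refine iUnion_congr fun k => ?_
    rw [← inter_iUnion, Metric.iUnion_closedBall_nat, inter_univ]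
  rw [hcover]
  refine AEMeasurable.iUnion fun k => AEMeasurable.iUnion fun j => ?_
  exact (hf _ (inter_subset_left.trans (hFΩ k))
    ((isCompact_closedBall _ _).inter_left (hF k))).aestronglyMeasurable.aemeasurable

end Comparison

theorem mainTheorem7 (n : ℕ) (hn : 1 ≤ n) (p : ℝ) (hp : 1 < p)
    (a q θ : ℝ) (ha : 1 < a) (hq : 0 < q) (hθ : 1 ≤ θ) :
    ∃ C : ℝ≥0, 0 < C ∧
      ∀ Ω : Set (SpaceTime n), IsOpen Ω →
        ∀ f : SpaceTime n → ℝ, (∃ δ : ℝ, 0 < δ ∧ MemLpLocOn δ Ω f) →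
          pbmoSeminorm p a q θ Ω f ≤ (C : ℝ≥0∞) * pbmoRefSeminorm p Ω f ∧
          pbmoRefSeminorm p Ω f ≤ (C : ℝ≥0∞) * pbmoSeminorm p a q θ Ω f ∧
          (pbmoSeminorm p a q θ Ω f < ∞ ↔ MemPBMO p Ω f) := by
  obtain ⟨C₁, hC₁, h₁⟩ := exists_pbmoSeminorm_le n hp (a := 3) (q := 1) (θ := 1) (by norm_num)
    one_pos le_rfl ha hq hθ
  obtain ⟨C₂, hC₂, h₂⟩ := exists_pbmoSeminorm_le n hp ha hq hθ (a' := 3) (q' := 1) (θ' := 1)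
    (by norm_num) one_pos le_rfl
  refine ⟨max C₁ C₂, lt_max_of_lt_left hC₁, ?_⟩
  rintro Ω hΩ f ⟨δ, -, hf⟩
  have hfm := hf.aemeasurable hΩ
  refine ⟨(h₁ Ω f hfm).trans ?_, (h₂ Ω f hfm).trans ?_, fun h => ?_, fun h => ?_⟩
  · exact mul_le_mul_left (ENNReal.coe_le_coe.2 (le_max_left _ _)) _
  · exact mul_le_mul_left (ENNReal.coe_le_coe.2 (le_max_right _ _)) _
  · have hlt : pbmoRefSeminorm p Ω f < ∞ :=
      (h₂ Ω f hfm).trans_lt (ENNReal.mul_lt_top ENNReal.coe_lt_top h)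
    exact ⟨locallyIntegrableOn_of_pbmoRefSeminorm_lt_top hp hΩ hfm hlt, hlt⟩
  · exact (h₁ Ω f hfm).trans_lt (ENNReal.mul_lt_top ENNReal.coe_lt_top h.2)
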